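/- **Conventions.** Graphs are simple. A *$2$-dimensional systolic complex* is a simply connected simplicial complex $Y$ of dimension at most $2$ such that, for every vertex $v$, the link of $v$ (the graph on the neighbours of $v$ in which two neighbours are adjacent when they span a triangle together with $v$) has girth at least $6$ (the girth of a graph without cycles being $\infty$). A *square complex* is a CW complex of dimension at most $2$ whose $1$-skeleton is a simple graph and whose $2$-cells (*squares*) are attached along embedded $4$-cycles of the $1$-skeleton, with at most one square attached to each embedded $4$-cycle. A *quadric complex* is a simply connected square complex $X$ satisfying the following two replacement rules. 1. If $u_0,u_1,v_0,v_1,v_2$ are distinct vertices such that the $4$-cycles $(u_0,v_0,u_1,v_1)$ and $(u_0,v_1,u_1,v_2)$ bound squares of $X$, then the $4$-cycle $(u_0,v_0,u_1,v_2)$ bounds a square of $X$. 2. If $u,a_0,a_1,a_2,b_0,b_1,b_2$ are distinct vertices such that the $4$-cycles $(u,a_0,b_0,a_1)$, $(u,a_1,b_1,a_2)$ and $(u,a_2,b_2,a_0)$ bound squares of $X$, then some pair of antipodal vertices of the $6$-cycle $(a_0,b_0,a_1,b_1,a_2,b_2)$ is joined by an edge of $X$ such that both $4$-cycles into which this edge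 divides the $6$-cycle bound squares of $X$. Let $Y$ be a $2$-dimensional systolic complex with a basepoint $\ast\in Y^0$, and let $d$ be the shortest path metric on $Y^0$ induced by the $1$-skeleton $Y^1$. Let $X_Y^1$ be the graph with vertex set $Y^0$ whose edges are the edges $\{v,w\}$ of $Y^1$ with $d(\ast,v)\neq d(\ast,w)$. The *squaring* $(X_Y,\ast)$ of $(Y,\ast)$ is the based square complex obtained from $X_Y^1$ by attaching a unique square along its boundary to each embedded $4$-cycle of $X_Y^1$. **Theorem.** Let $(Y,\ast)$ be a based $2$-dimensional systolic complex. Then the squaring $X_Y$ of $(Y,\ast)$ is a quadric complex. -/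

import Mathlib

namespace Quadric

universe u

/-! ### Simplicial complexes and their geometric realization -/

section Simplicial

variable {V : Type u}

/-- The points of the geometric realization of a simplicial complex, in barycentric coordinates:
nonnegative weights on the vertices, vanishing outside some face and summing to `1`. -/
def Realization (K : AbstractSimplicialComplex V) : Type u :=
  {f : V → ℝ // ∃ σ ∈ K.faces, (∀ v, 0 ≤ f v) ∧ (∀ v ∉ σ, f v = 0) ∧ ∑ v ∈ σ, f v = 1}

/-- The characteristic map of the face `σ`, from the standard simplex with vertex set `σ`:
barycentric coordinates are extended by zero. -/
noncomputable def faceMap (K : AbstractSimplicialComplex V) (σ : K.faces)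
    (p : stdSimplex ℝ (σ : Finset V)) : Realization K :=
  ⟨Function.extend Subtype.val p.1 (0 : V → ℝ), σ.1, σ.2, by
    have hval : ∀ v : (σ : Finset V),
        Function.extend (Subtype.val : {w // w ∈ σ.1} → V) p.1 (0 : V → ℝ) v.1 = p.1 v := fun v =>
      Subtype.val_injective.extend_apply _ _ v
    refine ⟨fun v => ?_, fun v hv => ?_, ?_⟩
    · by_cases hv : v ∈ (σ : Finset V)
      · exact (p.2.1 ⟨v, hv⟩).trans_eq (hval ⟨v, hv⟩).symm
      · rw [Function.extend_apply' _ _ _ (by rintro ⟨w, rfl⟩; exact hv w.2)]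
        exact le_refl _
    · rw [Function.extend_apply' _ _ _ (by rintro ⟨w, rfl⟩; exact hv w.2)]
      rfl
    · rw [← Finset.sum_coe_sort]
      exact (Finset.sum_congr rfl fun v _ => hval v).trans p.2.2⟩

/-- The weak (CW) topology on the geometric realization: the finest topology for which all the
characteristic maps of faces are continuous. A set is open iff its preimage in each closed simplex
is open. -/
noncomputable instance (K : AbstractSimplicialComplex V) : TopologicalSpace (Realization K) :=
  ⨆ σ : K.faces, TopologicalSpace.coinduced (faceMap K σ) inferInstance

/-- The `1`-skeleton of a simplicial complex. -/
def oneSkeleton (K : AbstractSimplicialComplex V) : SimpleGraph V where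
  Adj v w := v ≠ w ∧ ∃ t ∈ K.faces, (t : Set V) = {v, w}
  symm := ⟨fun v w h => ⟨h.1.symm, by rw [Set.pair_comm]; exact h.2⟩⟩
  loopless := ⟨fun _ h => h.1 rfl⟩

/-- The link of a vertex `v` in a `2`-dimensional simplicial complex: its vertices are the
neighbours of `v`, two of them being adjacent iff they span a triangle together with `v`. -/
def link (K : AbstractSimplicialComplex V) (v : V) :
    SimpleGraph ((oneSkeleton K).neighborSet v) where
  Adj w x := w ≠ x ∧ ∃ t ∈ K.faces, (t : Set V) = {v, w.1, x.1}
  symm := ⟨fun w x h => ⟨h.1.symm, by rw [Set.pair_comm]; exact h.2⟩⟩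
  loopless := ⟨fun _ h => h.1 rfl⟩

/-- A `2`-dimensional systolic complex: a simply connected simplicial complex of dimension at
most `2` in which the link of every vertex has girth at least `6`. (A graph without cycles has
infinite girth.) -/
structure IsTwoDimSystolic (K : AbstractSimplicialComplex V) : Prop where
  simplyConnected : SimplyConnectedSpace (Realization K)
  card_le_three : ∀ t ∈ K.faces, t.card ≤ 3
  six_le_girth_link : ∀ v, 6 ≤ (link K v).egirth

end Simplicial

/-! ### Square complexes -/

section Square

variable {V : Type u}

/-- The edge set of the closed path `a, b, c, d, a`. -/
def cycleEdges (a b c d : V) : Set (Sym2 V) := {s(a, b), s(b, c), s(c, d), s(d, a)}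

/-- `s` is the edge set of an embedded `4`-cycle of the graph `G`. -/
def IsFourCycle (G : SimpleGraph V) (s : Set (Sym2 V)) : Prop :=
  ∃ a b c d, [a, b, c, d].Nodup ∧ G.Adj a b ∧ G.Adj b c ∧ G.Adj c d ∧ G.Adj d a ∧
    s = cycleEdges a b c d

/-- A square complex with vertex set `V`: a simplicial graph, the `1`-skeleton, together with a
set of embedded `4`-cycles to each of which exactly one square is attached along its boundary.
An embedded `4`-cycle is recorded by its edge set, which determines it. -/
structure SquareComplex (V : Type u) where
  graph : SimpleGraph V
  squares : Set (Set (Sym2 V))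
  isFourCycle : ∀ s ∈ squares, IsFourCycle graph s

namespace SquareComplex

/-- There is a square with boundary path `a, b, c, d, a`. -/
def IsSquare (X : SquareComplex V) (a b c d : V) : Prop := cycleEdges a b c d ∈ X.squares

/-- The triangulation of a square complex obtained by starring each square: a square is the cone
on its boundary `4`-cycle, the apex being its centre. The vertices are the vertices of the square
complex and the centres of its squares; the maximal simplices are isolated vertices `{v}`,
edges `{v, w}` and triangles spanned by the centre of a square and one of its four sides. -/
def starring (X : SquareComplex V) : AbstractSimplicialComplex (V ⊕ X.squares) where
  faces := {t | t.Nonempty ∧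
    ((∃ v, (t : Set (V ⊕ X.squares)) ⊆ {Sum.inl v}) ∨
     (∃ v w, X.graph.Adj v w ∧ (t : Set (V ⊕ X.squares)) ⊆ {Sum.inl v, Sum.inl w}) ∨
     (∃ s : X.squares, ∃ v w, s(v, w) ∈ s.1 ∧
        (t : Set (V ⊕ X.squares)) ⊆ {Sum.inr s, Sum.inl v, Sum.inl w}))}
  isRelLowerSet_faces := by
    rintro t ⟨hne, ht⟩
    refine ⟨hne, fun t' htt' hne' => ⟨hne', ?_⟩⟩
    have hsub : (t' : Set (V ⊕ X.squares)) ⊆ t := Finset.coe_subset.2 htt'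
    rcases ht with ⟨v, h⟩ | ⟨v, w, hvw, h⟩ | ⟨s, v, w, hvw, h⟩
    · exact Or.inl ⟨v, hsub.trans h⟩
    · exact Or.inr (Or.inl ⟨v, w, hvw, hsub.trans h⟩)
    · exact Or.inr (Or.inr ⟨s, v, w, hvw, hsub.trans h⟩)
  singleton_mem := by
    rintro (v | s)
    · exact ⟨Finset.singleton_nonempty _, Or.inl ⟨v, by simp⟩⟩
    · obtain ⟨a, b, c, d, -, -, -, -, -, hs⟩ := X.isFourCycle s.1 s.2
      exact ⟨Finset.singleton_nonempty _, Or.inr (Or.inr ⟨s, a, b, by simp [hs, cycleEdges],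
        by simp⟩)⟩

/-- The topological space underlying a square complex (a CW complex of dimension at most `2`),
presented through the triangulation by starring each square. -/
abbrev Space (X : SquareComplex V) : Type u := Realization X.starring

/-- A quadric complex: a simply connected square complex satisfying the two replacement rules.

* If two squares meet along the path `u₀, v₁, u₁` and `v₀ ≠ v₂`, so that together they form a disc
  with boundary path `u₀, v₀, u₁, v₂`, then this boundary path bounds a square.
* If three squares fit around a common vertex `u`, forming a disc on seven distinct vertices with
  boundary path `a₀, b₀, a₁, b₁, a₂, b₂`, then this hexagon bounds two squares which share an edge
  joining one of the three pairs of antipodal vertices. -/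
structure IsQuadric (X : SquareComplex V) : Prop where
  simplyConnected : SimplyConnectedSpace X.Space
  replace_two : ∀ u₀ u₁ v₀ v₁ v₂ : V, [u₀, u₁, v₀, v₁, v₂].Nodup →
    X.IsSquare u₀ v₀ u₁ v₁ → X.IsSquare u₀ v₁ u₁ v₂ → X.IsSquare u₀ v₀ u₁ v₂
  replace_three : ∀ u a₀ a₁ a₂ b₀ b₁ b₂ : V, [u, a₀, a₁, a₂, b₀, b₁, b₂].Nodup →
    X.IsSquare u a₀ b₀ a₁ → X.IsSquare u a₁ b₁ a₂ → X.IsSquare u a₂ b₂ a₀ →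
      (X.IsSquare b₂ a₀ b₀ a₁ ∧ X.IsSquare a₁ b₁ a₂ b₂) ∨
      (X.IsSquare a₀ b₀ a₁ b₁ ∧ X.IsSquare b₁ a₂ b₂ a₀) ∨
      (X.IsSquare a₂ b₂ a₀ b₀ ∧ X.IsSquare b₀ a₁ b₁ a₂)

end SquareComplex

/-- The `1`-skeleton of the squaring of `(Y, o)`: all vertices of `Y`, and those edges of `Y` whose
endpoints are not equidistant from the basepoint `o` in the shortest path metric of the
`1`-skeleton of `Y`. -/
def squaringGraph (Y : AbstractSimplicialComplex V) (o : V) : SimpleGraph V where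
  Adj v w := (oneSkeleton Y).Adj v w ∧ (oneSkeleton Y).dist o v ≠ (oneSkeleton Y).dist o w
  symm := ⟨fun _ _ h => ⟨h.1.symm, h.2.symm⟩⟩
  loopless := ⟨fun _ h => h.2 rfl⟩

/-- The squaring of `(Y, o)`: a unique square is attached to each embedded `4`-cycle of the graph
`squaringGraph Y o`. -/
def squaring (Y : AbstractSimplicialComplex V) (o : V) : SquareComplex V where
  graph := squaringGraph Y o
  squares := {s | IsFourCycle (squaringGraph Y o) s}
  isFourCycle := fun _ hs => hs

end Square

end Quadric

/-! Everything rests on the shape of the metric spheres around the basepoint, recorded in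
`IsLayered`: the neighbours of `v` one step closer to `o` (its parents) pairwise span triangles with
`v`, and two adjacent equidistant vertices span a triangle with a vertex one step closer. Girth at
least 6 then leaves each vertex at most two parents.

This structure is global, and it is obtained without disc diagrams. Using only the link condition, a
candidate universal cover is built sphere by sphere (`Level.next`, `sphere`); absence of short link
cycles is exactly what makes the construction consistent. The result is a system of parallel
transports without holonomy in faces (`isLocalSystem_move`), hence a covering space of the
realization. Simple connectivity gives it a section (`IsLocalSystem.exists_section`), and the level
of the section turns out to be the distance from `o` (`IsLayered.eq_dist`).

Rule 1 is immediate, since every embedded 4-cycle of the squaring bounds a square. Rule 2 is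
vacuous: three squares around `u` would give a closed path in the link of `u`, either a cycle
shorter than 6 or a hexagon forcing some vertex to have three parents
(`IsLayered.not_three_corners`).

For simple connectivity, each vertex is joined to `o` by descending through parents. Two distinct
parents of a vertex have a common parent, and the four vertices bound a square
(`IsTwoDimSystolic.exists_square`), so by induction the homotopy class is independent of the
descent. These classes form a potential compatible with all edges, which forces simple connectivity
(`simplyConnectedSpace_of_potential`). -/

namespace Quadric

universe u

/-! ### Topology of the geometric realization: coordinates, segments, vertices. -/

section RealizationTopology

open Set Topology

variable {V : Type u} {K : AbstractSimplicialComplex V}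

namespace Realization

/-- The barycentric coordinates of a point. -/
def coord (f : Realization K) : V → ℝ := Subtype.val f

theorem ext {f g : Realization K} (h : ∀ v, f.coord v = g.coord v) : f = g :=
  Subtype.ext (funext h)

/-- `σ` is a face of `K` containing the support of `f`. -/
def SupportedIn (f : Realization K) (σ : Finset V) : Prop :=
  σ ∈ K.faces ∧ ∀ v ∉ σ, f.coord v = 0

theorem exists_supportedIn (f : Realization K) : ∃ σ, f.SupportedIn σ := by
  obtain ⟨σ, hσ, -, h, -⟩ := f.2
  exact ⟨σ, hσ, h⟩

theorem nonneg (f : Realization K) (v : V) : 0 ≤ f.coord v := by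
  obtain ⟨σ, hσ, h, -, -⟩ := f.2
  exact h v

theorem SupportedIn.mem {f : Realization K} {σ : Finset V} (h : f.SupportedIn σ) {v : V}
    (hv : 0 < f.coord v) : v ∈ σ := by
  by_contra hn
  exact hv.ne' (h.2 v hn)

theorem SupportedIn.sum_eq_one {f : Realization K} {σ : Finset V} (h : f.SupportedIn σ) :
    ∑ v ∈ σ, f.coord v = 1 := by
  classical
  obtain ⟨τ, hτ, -, h0, h1⟩ := f.2
  replace h0 : ∀ v ∉ τ, f.coord v = 0 := h0
  replace h1 : ∑ v ∈ τ, f.coord v = 1 := h1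
  rw [← h1]
  have e1 : ∑ v ∈ σ, f.coord v = ∑ v ∈ σ ∪ τ, f.coord v :=
    Finset.sum_subset Finset.subset_union_left fun v _ hv => h.2 v hv
  have e2 : ∑ v ∈ τ, f.coord v = ∑ v ∈ σ ∪ τ, f.coord v :=
    Finset.sum_subset Finset.subset_union_right fun v _ hv => h0 v hv
  rw [e1, e2]

theorem exists_pos (f : Realization K) : ∃ v, 0 < f.coord v := by
  obtain ⟨σ, hσ⟩ := f.exists_supportedIn
  by_contra! hn
  have : ∑ v ∈ σ, f.coord v ≤ 0 := Finset.sum_nonpos fun v _ => hn v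
  rw [hσ.sum_eq_one] at this
  linarith

end Realization

open Realization

theorem faceMap_apply_mem {σ : K.faces} (p : stdSimplex ℝ (σ : Finset V)) {v : V}
    (hv : v ∈ σ.1) : (faceMap K σ p).coord v = p.1 ⟨v, hv⟩ :=
  Subtype.val_injective.extend_apply p.1 (0 : V → ℝ) ⟨v, hv⟩

theorem faceMap_apply_notMem {σ : K.faces} (p : stdSimplex ℝ (σ : Finset V)) {v : V}
    (hv : v ∉ σ.1) : (faceMap K σ p).coord v = 0 :=
  Function.extend_apply' _ _ _ (by rintro ⟨w, rfl⟩; exact hv w.2)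

theorem faceMap_supportedIn {σ : K.faces} (p : stdSimplex ℝ (σ : Finset V)) :
    (faceMap K σ p).SupportedIn σ.1 :=
  ⟨σ.2, fun _ hv => faceMap_apply_notMem p hv⟩

theorem continuous_faceMap (σ : K.faces) : Continuous (faceMap K σ) :=
  continuous_iSup_rng (i := σ) continuous_coinduced_rng

theorem continuous_realization_iff {Z : Type*} [TopologicalSpace Z] {h : Realization K → Z} :
    Continuous h ↔ ∀ σ : K.faces, Continuous (h ∘ faceMap K σ) := by
  refine continuous_iSup_dom.trans (forall_congr' fun σ => continuous_coinduced_dom)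

theorem continuous_coord (v : V) : Continuous fun f : Realization K => f.coord v := by
  refine continuous_realization_iff.2 fun σ => ?_
  by_cases hv : v ∈ σ.1
  · have : (fun f : Realization K => f.coord v) ∘ faceMap K σ = fun p => p.1 ⟨v, hv⟩ :=
      funext fun p => faceMap_apply_mem p hv
    rw [this]
    exact (continuous_apply _).comp continuous_subtype_val
  · have : (fun f : Realization K => f.coord v) ∘ faceMap K σ = fun p => 0 :=
      funext fun p => faceMap_apply_notMem p hv
    rw [this]
    exact continuous_const

/-- The barycentric coordinates of a point of the face `σ`. -/
def Realization.SupportedIn.coords {f : Realization K} {σ : Finset V} (h : f.SupportedIn σ) :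
    stdSimplex ℝ (σ : Finset V) :=
  ⟨fun v => f.coord v, fun v => f.nonneg v, by
    rw [Finset.sum_coe_sort σ (fun v => f.coord v)]; exact h.sum_eq_one⟩

theorem faceMap_coords {f : Realization K} {σ : Finset V} (h : f.SupportedIn σ) :
    faceMap K ⟨σ, h.1⟩ h.coords = f := by
  refine Realization.ext fun v => ?_
  by_cases hv : v ∈ σ
  · rw [faceMap_apply_mem _ hv]; rfl
  · rw [faceMap_apply_notMem _ hv, h.2 v hv]

/-- A map into a closed simplex is continuous as soon as its coordinates are. -/
theorem continuous_of_supportedIn {Z : Type*} [TopologicalSpace Z] {h : Z → Realization K}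
    {σ : Finset V} (hs : ∀ z, (h z).SupportedIn σ)
    (hc : ∀ v ∈ σ, Continuous fun z => (h z).coord v) : Continuous h := by
  by_cases hZ : Nonempty Z
  · obtain ⟨z₀⟩ := hZ
    have : h = faceMap K ⟨σ, (hs z₀).1⟩ ∘ fun z => (hs z).coords :=
      funext fun z => (faceMap_coords (hs z)).symm
    rw [this]
    refine (continuous_faceMap _).comp (Continuous.subtype_mk ?_ _)
    exact continuous_pi fun v => hc v v.2
  · exact continuous_iff_continuousAt.2 fun z => (hZ ⟨z⟩).elim

theorem isOpen_pos (v : V) : IsOpen {f : Realization K | 0 < f.coord v} :=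
  isOpen_lt continuous_const (continuous_coord v)

/-! ### Segments -/

/-- The point dividing the segment from `f` to `g` inside a closed simplex. -/
def linePoint {σ : Finset V} {f g : Realization K} (hf : f.SupportedIn σ) (hg : g.SupportedIn σ)
    (t : unitInterval) : Realization K :=
  ⟨fun v => (1 - (t : ℝ)) * f.coord v + t * g.coord v, σ, hf.1,
    fun v => add_nonneg (mul_nonneg (sub_nonneg.2 t.2.2) (f.nonneg v))
      (mul_nonneg t.2.1 (g.nonneg v)),
    fun v hv => by dsimp only; rw [hf.2 v hv, hg.2 v hv]; ring,
    by rw [Finset.sum_add_distrib, ← Finset.mul_sum, ← Finset.mul_sum, hf.sum_eq_one,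
      hg.sum_eq_one]; ring⟩

theorem linePoint_coord {σ : Finset V} {f g : Realization K} (hf : f.SupportedIn σ)
    (hg : g.SupportedIn σ) (t : unitInterval) (v : V) :
    (linePoint hf hg t).coord v = (1 - (t : ℝ)) * f.coord v + t * g.coord v := rfl

theorem linePoint_supportedIn {σ : Finset V} {f g : Realization K} (hf : f.SupportedIn σ)
    (hg : g.SupportedIn σ) (t : unitInterval) : (linePoint hf hg t).SupportedIn σ :=
  ⟨hf.1, fun v hv => by simp [linePoint_coord, hf.2 v hv, hg.2 v hv]⟩

/-- The straight segment between two points of a closed simplex. -/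
def segmentPath {σ : Finset V} {f g : Realization K} (hf : f.SupportedIn σ)
    (hg : g.SupportedIn σ) : Path f g where
  toFun := linePoint hf hg
  continuous_toFun := continuous_of_supportedIn (linePoint_supportedIn hf hg) fun v _ => by
    simp only [linePoint_coord]; fun_prop
  source' := Realization.ext fun v => by simp [linePoint_coord]
  target' := Realization.ext fun v => by simp [linePoint_coord]

theorem segmentPath_apply {σ : Finset V} {f g : Realization K} (hf : f.SupportedIn σ)
    (hg : g.SupportedIn σ) (t : unitInterval) (v : V) :
    (segmentPath hf hg t).coord v = (1 - (t : ℝ)) * f.coord v + t * g.coord v := rfl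

/-! ### Vertices -/

open Classical in
/-- A vertex of `K` as a point of the geometric realization. -/
noncomputable def vertexPoint (K : AbstractSimplicialComplex V) (v : V) : Realization K :=
  ⟨fun w => if w = v then 1 else 0, {v}, K.singleton_mem v,
    fun w => by dsimp only; split_ifs <;> norm_num, fun w hw => by simpa using hw, by simp⟩

open Classical in
theorem vertexPoint_apply (v w : V) : (vertexPoint K v).coord w = if w = v then 1 else 0 := rfl

theorem vertexPoint_self (v : V) : (vertexPoint K v).coord v = 1 := by
  simp [vertexPoint_apply]

theorem vertexPoint_pos_iff {v w : V} : 0 < (vertexPoint K v).coord w ↔ w = v := by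
  classical
  rw [vertexPoint_apply]; split_ifs with h <;> simp [h]

theorem vertexPoint_supportedIn {v : V} {σ : Finset V} (hσ : σ ∈ K.faces) (hv : v ∈ σ) :
    (vertexPoint K v).SupportedIn σ := by
  classical
  refine ⟨hσ, fun w hw => ?_⟩
  rw [vertexPoint_apply, if_neg]
  rintro rfl
  exact hw hv

/-! ### Local path connectedness -/

/-- Exhibits the realization as a single quotient of a disjoint union of simplices, so that local
path connectedness, needed for lifting to covers, descends from simplices. -/
theorem realization_topology_eq :
    instTopologicalSpaceRealization K =
      TopologicalSpace.coinduced
        (fun x : Σ σ : K.faces, stdSimplex ℝ (σ : Finset V) => faceMap K x.1 x.2)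
        inferInstance := by
  refine le_antisymm (iSup_le fun σ => ?_) ?_
  · have h := coinduced_mono (f := fun x : Σ σ : K.faces, stdSimplex ℝ (σ : Finset V) =>
      faceMap K x.1 x.2) (continuous_sigmaMk (i := σ)).coinduced_le
    rwa [coinduced_compose] at h
  · rw [← continuous_iff_coinduced_le]
    exact continuous_sigma fun σ : K.faces => continuous_faceMap σ

instance : LocallyPathConnectedSpace (Realization K) := by
  have : ∀ σ : K.faces, LocallyPathConnectedSpace (stdSimplex ℝ (σ : Finset V)) := fun σ =>
    (convex_stdSimplex ℝ (σ : Finset V)).locallyPathConnectedSpace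
  have h := LocallyPathConnectedSpace.coinduced
    (fun x : Σ σ : K.faces, stdSimplex ℝ (σ : Finset V) => faceMap K x.1 x.2)
  rwa [← realization_topology_eq] at h

end RealizationTopology

/-! ### Covering spaces from parallel transports on vertices. -/

section LocalSystems

open Set Topology

variable {V E : Type u} {K : AbstractSimplicialComplex V} {p : E → V} {R : E → E → Prop}

/-- The relation `R` on the total space of `p : E → V` is a system of parallel transports
between the fibres over the vertices of each face of `K`, without holonomy inside a face. -/
structure IsLocalSystem (K : AbstractSimplicialComplex V) (p : E → V) (R : E → E → Prop) :
    Prop where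
  refl : ∀ e, R e e
  symm : ∀ {e e'}, R e e' → R e' e
  trans : ∀ {e e' e''} {σ : Finset V}, σ ∈ K.faces → p e ∈ σ → p e' ∈ σ → p e'' ∈ σ →
    R e e' → R e' e'' → R e e''
  exists_lift : ∀ e w (σ : Finset V), σ ∈ K.faces → p e ∈ σ → w ∈ σ → ∃ e', p e' = w ∧ R e e'
  unique : ∀ {e e' e''}, R e e' → R e e'' → p e' = p e'' → e' = e''

namespace IsLocalSystem

/-- The disjoint union of the open stars of the vertices `p e`, over all `e : E`. -/
abbrev Sheets (K : AbstractSimplicialComplex V) (p : E → V) : Type u :=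
  Σ e : E, {f : Realization K // 0 < f.coord (p e)}

theorem trans_of_pos (h : IsLocalSystem K p R) (f : Realization K) {e e' e'' : E}
    (h1 : 0 < f.coord (p e)) (h2 : 0 < f.coord (p e')) (h3 : 0 < f.coord (p e''))
    (h12 : R e e') (h23 : R e' e'') : R e e'' := by
  obtain ⟨σ, hσ⟩ := f.exists_supportedIn
  exact h.trans hσ.1 (hσ.mem h1) (hσ.mem h2) (hσ.mem h3) h12 h23

theorem exists_lift_of_pos (h : IsLocalSystem K p R) (f : Realization K) {e : E} {w : V}
    (h1 : 0 < f.coord (p e)) (h2 : 0 < f.coord w) : ∃ e', p e' = w ∧ R e e' := by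
  obtain ⟨σ, hσ⟩ := f.exists_supportedIn
  exact h.exists_lift e w σ hσ.1 (hσ.mem h1) (hσ.mem h2)

/-- Gluing of open stars along the transports. -/
def sheetSetoid (h : IsLocalSystem K p R) : Setoid (Sheets K p) where
  r x y := x.2.1 = y.2.1 ∧ R x.1 y.1
  iseqv :=
    { refl := fun x => ⟨rfl, h.refl _⟩
      symm := fun hxy => ⟨hxy.1.symm, h.symm hxy.2⟩
      trans := by
        rintro ⟨e, f, hf⟩ ⟨e', f', hf'⟩ ⟨e'', f'', hf''⟩ ⟨h1, h2⟩ ⟨h3, h4⟩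
        dsimp only at h1 h2 h3 h4 hf hf' hf''
        subst h1 h3
        exact ⟨rfl, h.trans_of_pos f hf hf' hf'' h2 h4⟩ }

/-- The covering space of the realization determined by a local system. -/
abbrev Cover (h : IsLocalSystem K p R) : Type u := Quotient h.sheetSetoid

/-- The point of the sheet `e` over `f`. -/
def Cover.mk (h : IsLocalSystem K p R) (e : E) (f : Realization K) (hf : 0 < f.coord (p e)) :
    h.Cover :=
  Quotient.mk h.sheetSetoid ⟨e, f, hf⟩

/-- The covering projection. -/
def Cover.proj (h : IsLocalSystem K p R) : h.Cover → Realization K :=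
  Quotient.lift (fun x => x.2.1) fun _ _ hxy => hxy.1

variable (h : IsLocalSystem K p R)

theorem Cover.proj_mk {e : E} {f : Realization K} (hf : 0 < f.coord (p e)) :
    Cover.proj h (Cover.mk h e f hf) = f := rfl

theorem Cover.exists_rep (z : h.Cover) :
    ∃ e f, ∃ hf : 0 < f.coord (p e), z = Cover.mk h e f hf := by
  obtain ⟨⟨e, f, hf⟩, rfl⟩ := Quotient.exists_rep z
  exact ⟨e, f, hf, rfl⟩

theorem Cover.mk_eq_iff {e e' : E} {f f' : Realization K} (hf : 0 < f.coord (p e))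
    (hf' : 0 < f'.coord (p e')) :
    Cover.mk h e f hf = Cover.mk h e' f' hf' ↔ f = f' ∧ R e e' :=
  Quotient.eq (r := h.sheetSetoid)

theorem Cover.continuous_mk {Z : Type*} [TopologicalSpace Z] (e : E) {g : Z → Realization K}
    (hg : Continuous g) (hpos : ∀ z, 0 < (g z).coord (p e)) :
    Continuous fun z => Cover.mk h e (g z) (hpos z) :=
  continuous_quotient_mk'.comp (continuous_sigmaMk.comp (hg.subtype_mk hpos))

theorem Cover.continuous_proj : Continuous (Cover.proj h) :=
  Continuous.quotient_lift (continuous_sigma fun _ => continuous_subtype_val) _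

/-- Gluing preserves the underlying point, so on sheet `e` the saturation of an open set is a union,
over the `e'` related to `e`, of its traces on overlaps of open stars. -/
theorem isOpenMap_mk : IsOpenMap (Quotient.mk h.sheetSetoid) := by
  intro W hW
  rw [isOpen_coinduced, isOpen_sigma_iff]
  intro e
  have : Sigma.mk e ⁻¹' (Quotient.mk h.sheetSetoid ⁻¹' (Quotient.mk h.sheetSetoid '' W)) =
      ⋃ (e' : E) (_ : R e' e), {f | ∃ hf : 0 < f.1.coord (p e'),
        (⟨f.1, hf⟩ : {f : Realization K // 0 < f.coord (p e')}) ∈ Sigma.mk e' ⁻¹' W} := by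
    ext ⟨f, hf⟩
    simp only [mem_preimage, mem_image, mem_iUnion, mem_ofPred_eq]
    constructor
    · rintro ⟨⟨e', f', hf'⟩, hx, hxe⟩
      obtain ⟨rfl, h2⟩ := (Cover.mk_eq_iff h hf' hf).1 hxe
      exact ⟨e', h2, hf', hx⟩
    · rintro ⟨e', h2, hf', hx⟩
      exact ⟨_, hx, (Cover.mk_eq_iff h hf' hf).2 ⟨rfl, h2⟩⟩
  refine (congrArg IsOpen this).mpr ?_
  refine isOpen_iUnion fun e' => isOpen_iUnion fun _ => ?_
  have hW' : IsOpen (Sigma.mk e' ⁻¹' W) := hW.preimage continuous_sigmaMk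
  obtain ⟨O, hO, hOW⟩ := isOpen_induced_iff.1 hW'
  have : {f : {f : Realization K // 0 < f.coord (p e)} | ∃ hf : 0 < f.1.coord (p e'),
        (⟨f.1, hf⟩ : {f : Realization K // 0 < f.coord (p e')}) ∈ Sigma.mk e' ⁻¹' W} =
      Subtype.val ⁻¹' ({f | 0 < f.coord (p e')} ∩ O) := by
    rw [← hOW]
    ext f
    simp
  rw [this]
  exact ((isOpen_pos _).inter hO).preimage continuous_subtype_val

/-- The cover is trivial over the open star of `v`. -/
noncomputable def starEquiv (v : V) : {f : Realization K | 0 < f.coord v} × {e : E // p e = v} ≃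
    Cover.proj h ⁻¹' {f : Realization K | 0 < f.coord v} :=
  Equiv.ofBijective
    (fun x => ⟨Cover.mk h x.2.1 x.1.1 (by rw [x.2.2]; exact x.1.2), x.1.2⟩) <| by
    constructor
    · rintro ⟨⟨f, hf⟩, e, he⟩ ⟨⟨f', hf'⟩, e', he'⟩ heq
      obtain ⟨rfl, h2⟩ := (Cover.mk_eq_iff h _ _).1 (Subtype.ext_iff.1 heq)
      obtain rfl := h.unique (h.refl e) h2 (he.trans he'.symm)
      rfl
    · rintro ⟨z, hz⟩
      obtain ⟨e, f, hf, rfl⟩ := Cover.exists_rep h z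
      obtain ⟨e', he', h2⟩ := h.exists_lift_of_pos f hf hz
      exact ⟨⟨⟨f, hz⟩, e', he'⟩, Subtype.ext ((Cover.mk_eq_iff h _ _).2 ⟨rfl, h.symm h2⟩)⟩

/-- Open stars of vertices cover the realization, and `starEquiv` trivializes the projection over
each, with fibre the discrete set of lifts of the vertex. -/
theorem isCoveringMap_proj : IsCoveringMap (Cover.proj h) := by
  intro f
  obtain ⟨v, hv⟩ := f.exists_pos
  let : TopologicalSpace {e : E // p e = v} := ⊥
  have : DiscreteTopology {e : E // p e = v} := ⟨rfl⟩
  refine IsEvenlyCovered.to_isEvenlyCovered_preimage (I := {e : E // p e = v})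
    ⟨inferInstance, {f | 0 < f.coord v}, hv, isOpen_pos v,
      (isOpen_pos v).preimage (Cover.continuous_proj h), ?_⟩
  refine ⟨((h.starEquiv v).toHomeomorphOfContinuousOpen ?_ ?_).symm, ?_⟩
  · refine Continuous.subtype_mk ?_ _
    refine continuous_prod_of_discrete_right.2 fun e => ?_
    exact Cover.continuous_mk h e.1 continuous_subtype_val _
  · intro W hW
    let j : {f : Realization K | 0 < f.coord v} × {e : E // p e = v} → Sheets K p :=
      fun x => ⟨x.2.1, x.1.1, by rw [x.2.2]; exact x.1.2⟩
    have hj : IsOpen (j '' W) := by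
      refine isOpen_sigma_iff.2 fun e => ?_
      by_cases he : p e = v
      · subst he
        have : Sigma.mk e ⁻¹' (j '' W) = (fun f => ((f, ⟨e, rfl⟩) :
            {f : Realization K | 0 < f.coord (p e)} × {e' : E // p e' = p e})) ⁻¹' W := by
          ext f
          constructor
          · rintro ⟨⟨f', e', he'⟩, hx, hxe⟩
            obtain rfl : e' = e := congrArg Sigma.fst hxe
            obtain rfl : f' = f := eq_of_heq (Sigma.mk.inj hxe).2
            exact hx
          · exact fun hf => ⟨_, hf, rfl⟩
        rw [this]
        exact hW.preimage (by fun_prop)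
      · have : Sigma.mk e ⁻¹' (j '' W) = ∅ := by
          refine eq_empty_of_forall_notMem fun f => ?_
          rintro ⟨⟨f', e', he'⟩, hx, hxe⟩
          exact he ((congrArg (fun x => p x.1) hxe).symm.trans he')
        rw [this]
        exact isOpen_empty
    refine isOpen_induced_iff.2 ⟨_, h.isOpenMap_mk _ hj, ?_⟩
    ext z
    constructor
    · rintro ⟨_, ⟨x, hx, rfl⟩, hxz⟩
      exact ⟨x, hx, Subtype.ext hxz⟩
    · rintro ⟨x, hx, rfl⟩
      exact ⟨_, ⟨x, hx, rfl⟩, rfl⟩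
  · intro z
    obtain ⟨x, rfl⟩ := (h.starEquiv v).surjective z
    change ((h.starEquiv v).symm (h.starEquiv v x)).1.1 = _
    rw [Equiv.symm_apply_apply]
    rfl

/-- Over a simply connected complex, every local system has a global section through any given
point. -/
theorem exists_section (h : IsLocalSystem K p R) [SimplyConnectedSpace (Realization K)] (e₀ : E) :
    ∃ s : V → E, (∀ v, p (s v) = v) ∧ s (p e₀) = e₀ ∧
      ∀ σ ∈ K.faces, ∀ v ∈ σ, ∀ w ∈ σ, R (s v) (s w) := by
  classical
  have hv : ∀ v, 0 < (vertexPoint K v).coord v := fun v => vertexPoint_pos_iff.2 rfl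
  -- The identity map lifts to the cover; the values of this lift at vertices define the section.
  obtain ⟨F, ⟨hF₀, hF⟩, -⟩ := h.isCoveringMap_proj.existsUnique_continuousMap_lifts
    (ContinuousMap.id (Realization K)) (vertexPoint K (p e₀)) (Cover.mk h e₀ _ (hv _)) rfl
  have hF' : ∀ f, Cover.proj h (F f) = f := fun f => congrFun hF f
  have key : ∀ v, ∃ e, ∃ he : p e = v, F (vertexPoint K v) =
      Cover.mk h e (vertexPoint K v) (by rw [he]; exact hv v) := by
    intro v
    obtain ⟨e, f, hf, hz⟩ := Cover.exists_rep h (F (vertexPoint K v))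
    have hfv : vertexPoint K v = f := by
      rw [← hF' (vertexPoint K v), hz, Cover.proj_mk]
    subst hfv
    exact ⟨e, vertexPoint_pos_iff.1 hf, hz⟩
  choose s hs hFs using key
  -- A lift cannot change sheet along a path that stays in one open star, by uniqueness of lifts.
  have along : ∀ (e : E) (f g : Realization K) (hf : 0 < f.coord (p e)) (γ : Path f g)
      (hγ : ∀ t, 0 < (γ t).coord (p e)) (_ : F f = Cover.mk h e f hf),
      F g = Cover.mk h e g (by simpa using hγ 1) := by
    intro e f g hf γ hγ hFf
    have := h.isCoveringMap_proj.eq_of_comp_eq (g₁ := fun t => F (γ t))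
      (g₂ := fun t => Cover.mk h e (γ t) (hγ t)) (F.continuous.comp γ.continuous)
      (Cover.continuous_mk h e γ.continuous hγ) (funext fun t => hF' (γ t)) 0
      (by simpa using hFf)
    simpa using congrFun this 1
  refine ⟨s, hs, ?_, ?_⟩
  · have := (hFs (p e₀)).symm.trans hF₀
    exact h.unique (h.refl _) ((Cover.mk_eq_iff h _ _).1 this).2 (hs _)
  · intro σ hσ v hvσ w hwσ
    have h1 := vertexPoint_supportedIn hσ hvσ
    have h2 := vertexPoint_supportedIn hσ hwσ
    -- The midpoint lies in the open stars of both `v` and `w`, so the sheets of `s v` and `s w` can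
    -- be compared there.
    let m := linePoint h1 h2 ⟨1 / 2, by norm_num, by norm_num⟩
    have hm : m.SupportedIn σ := linePoint_supportedIn _ _ _
    have hmv : 0 < m.coord v := by
      have := (vertexPoint K w).nonneg v
      simp only [m, linePoint_coord, vertexPoint_self]
      linarith
    have hmw : 0 < m.coord w := by
      have := (vertexPoint K v).nonneg w
      simp only [m, linePoint_coord, vertexPoint_self]
      linarith
    have pos : ∀ (u : V) (hu : u ∈ σ), 0 < m.coord u → ∀ t,
        0 < (segmentPath (vertexPoint_supportedIn hσ hu) hm t).coord u := by
      intro u hu hmu t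
      rw [segmentPath_apply, vertexPoint_self]
      rcases t.2.1.eq_or_lt with ht | ht
      · rw [← ht]; norm_num
      · have := sub_nonneg.2 t.2.2
        have := mul_pos ht hmu
        linarith
    have a1 := along (s v) _ m (by rw [hs]; exact hv v) (segmentPath h1 hm)
      (by rw [hs]; exact pos v hvσ hmv) (hFs v)
    have a2 := along (s w) _ m (by rw [hs]; exact hv w) (segmentPath h2 hm)
      (by rw [hs]; exact pos w hwσ hmw) (hFs w)
    exact ((Cover.mk_eq_iff h _ _).1 (a1.symm.trans a2)).2

end IsLocalSystem

end LocalSystems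

/-! ### Homotopy classes of paths and a criterion for simple connectivity. -/

section Potentials

open Set Topology

variable {V : Type u} {K : AbstractSimplicialComplex V}

open Path.Homotopic (Quotient)

theorem homotopic_of_supportedIn {σ : Finset V} {f g : Realization K} {γ γ' : Path f g}
    (hγ : ∀ t, (γ t).SupportedIn σ) (hγ' : ∀ t, (γ' t).SupportedIn σ) : γ.Homotopic γ' :=
  ⟨{ toFun := fun x => linePoint (hγ x.2) (hγ' x.2) x.1
     continuous_toFun := continuous_of_supportedIn (fun _ => linePoint_supportedIn _ _ _)
      fun v _ => by
        have h1 : Continuous fun x : unitInterval × unitInterval => (γ x.2).coord v :=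
          (continuous_coord v).comp (γ.continuous.comp continuous_snd)
        have h2 : Continuous fun x : unitInterval × unitInterval => (γ' x.2).coord v :=
          (continuous_coord v).comp (γ'.continuous.comp continuous_snd)
        simp only [linePoint_coord]
        fun_prop
     map_zero_left := fun t => Realization.ext fun v => by simp [linePoint_coord]
     map_one_left := fun t => Realization.ext fun v => by simp [linePoint_coord]
     prop' := by
      rintro t x (rfl | rfl) <;> exact Realization.ext fun v => by
        simp [linePoint_coord]; ring }⟩

/-- The homotopy class of the segment between two points of a face. -/
noncomputable def segmentClass {σ : Finset V} {f g : Realization K} (hf : f.SupportedIn σ)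
    (hg : g.SupportedIn σ) : Path.Homotopic.Quotient f g :=
  .mk (segmentPath hf hg)

theorem segmentPath_supportedIn {σ : Finset V} {f g : Realization K} (hf : f.SupportedIn σ)
    (hg : g.SupportedIn σ) (t : unitInterval) : (segmentPath hf hg t).SupportedIn σ :=
  linePoint_supportedIn hf hg t

theorem segmentClass_trans {σ : Finset V} {f g k : Realization K} (hf : f.SupportedIn σ)
    (hg : g.SupportedIn σ) (hk : k.SupportedIn σ) :
    (segmentClass hf hg).trans (segmentClass hg hk) = segmentClass hf hk := by
  rw [segmentClass, segmentClass, ← Path.Homotopic.Quotient.mk_trans]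
  refine Path.Homotopic.Quotient.eq.2 (homotopic_of_supportedIn (σ := σ) (fun t => ?_)
    (segmentPath_supportedIn hf hk))
  rw [Path.trans_apply]
  split_ifs
  · exact segmentPath_supportedIn _ _ _
  · exact segmentPath_supportedIn _ _ _

theorem segmentClass_self {σ : Finset V} {f : Realization K} (hf : f.SupportedIn σ) :
    segmentClass hf hf = Path.Homotopic.Quotient.refl f :=
  Path.Homotopic.Quotient.eq.2 (homotopic_of_supportedIn (segmentPath_supportedIn hf hf)
    fun _ => hf)

/-- The two ways around the boundary of the unit square are homotopic because the square is
contractible; `F` carries this homotopy to `X`. -/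
theorem mk_trans_mk_of_square {X : Type*} [TopologicalSpace X]
    (F : C(unitInterval × unitInterval, X)) {a b c d : X} (bottom : Path a b) (top : Path c d)
    (left : Path a c) (right : Path b d) (hb : ∀ t, F (t, 0) = bottom t)
    (ht : ∀ t, F (t, 1) = top t) (hl : ∀ s, F (0, s) = left s) (hr : ∀ s, F (1, s) = right s) :
    (Path.Homotopic.Quotient.mk bottom).trans (.mk right) =
      (Path.Homotopic.Quotient.mk left).trans (.mk top) := by
  obtain rfl : F (0, 0) = a := by simp [hb]
  obtain rfl : F (1, 0) = b := by simp [hb]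
  obtain rfl : F (0, 1) = c := by simp [ht]
  obtain rfl : F (1, 1) = d := by simp [ht]
  let b' : Path ((0, 0) : unitInterval × unitInterval) (1, 0) := Path.id.prod (Path.refl 0)
  let t' : Path ((0, 1) : unitInterval × unitInterval) (1, 1) := Path.id.prod (Path.refl 1)
  let l' : Path ((0, 0) : unitInterval × unitInterval) (0, 1) := (Path.refl 0).prod Path.id
  let r' : Path ((1, 0) : unitInterval × unitInterval) (1, 1) := (Path.refl 1).prod Path.id
  have eb : bottom = b'.map F.continuous := Path.ext (funext fun t => (hb t).symm)
  have et : top = t'.map F.continuous := Path.ext (funext fun t => (ht t).symm)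
  have el : left = l'.map F.continuous := Path.ext (funext fun t => (hl t).symm)
  have er : right = r'.map F.continuous := Path.ext (funext fun t => (hr t).symm)
  have hc : ContractibleSpace unitInterval :=
    (convex_Icc (0 : ℝ) 1).contractibleSpace ⟨0, by simp⟩
  rw [eb, et, el, er, ← Path.Homotopic.Quotient.mk_trans, ← Path.Homotopic.Quotient.mk_trans,
    ← Path.map_trans, ← Path.map_trans]
  exact Path.Homotopic.Quotient.eq.2
    ((SimplyConnectedSpace.paths_homotopic (b'.trans r') (l'.trans t')).map F)

/-! ### Contracting open stars -/

/-- The fraction of the way to the vertex `v` travelled by `f` at time `s`. -/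
noncomputable def contractRatio (v : V) (ε : ℝ) (f : Realization K) (s : unitInterval) : ℝ :=
  s * min 1 (f.coord v / ε)

theorem contractRatio_eq_zero {v : V} {ε : ℝ} {f : Realization K} (hf : f.coord v = 0)
    (s : unitInterval) : contractRatio v ε f s = 0 := by
  simp [contractRatio, hf]

/-- A deformation of the realization which contracts `{f | ε ≤ f v}` to `v`. -/
noncomputable def contract (v : V) {ε : ℝ} (hε : 0 < ε) (f : Realization K) (s : unitInterval) :
    Realization K :=
  ⟨fun w => (1 - contractRatio v ε f s) * f.coord w +
      contractRatio v ε f s * (vertexPoint K v).coord w, by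
    obtain ⟨σ, hσ⟩ := f.exists_supportedIn
    have h0 : 0 ≤ contractRatio v ε f s :=
      mul_nonneg s.2.1 (le_min zero_le_one (div_nonneg (f.nonneg v) hε.le))
    have h1 : contractRatio v ε f s ≤ 1 :=
      mul_le_one₀ s.2.2 (le_min zero_le_one (div_nonneg (f.nonneg v) hε.le)) (min_le_left _ _)
    refine ⟨σ, hσ.1, fun w => ?_, fun w hw => ?_, ?_⟩
    · exact add_nonneg (mul_nonneg (sub_nonneg.2 h1) (f.nonneg w))
        (mul_nonneg h0 ((vertexPoint K v).nonneg w))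
    · dsimp only
      by_cases hv : v ∈ σ
      · rw [hσ.2 w hw, (vertexPoint_supportedIn hσ.1 hv).2 w hw]; ring
      · rw [contractRatio_eq_zero (hσ.2 v hv), hσ.2 w hw]; ring
    · dsimp only
      rw [Finset.sum_add_distrib, ← Finset.mul_sum, ← Finset.mul_sum, hσ.sum_eq_one]
      by_cases hv : v ∈ σ
      · rw [(vertexPoint_supportedIn hσ.1 hv).sum_eq_one]; ring
      · rw [contractRatio_eq_zero (hσ.2 v hv)]; ring⟩

theorem contract_coord (v : V) {ε : ℝ} (hε : 0 < ε) (f : Realization K) (s : unitInterval)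
    (w : V) : (contract v hε f s).coord w = (1 - contractRatio v ε f s) * f.coord w +
      contractRatio v ε f s * (vertexPoint K v).coord w := rfl

theorem contract_supportedIn (v : V) {ε : ℝ} (hε : 0 < ε) {f : Realization K} {σ : Finset V}
    (hσ : f.SupportedIn σ) (s : unitInterval) : (contract v hε f s).SupportedIn σ := by
  refine ⟨hσ.1, fun w hw => ?_⟩
  rw [contract_coord]
  by_cases hv : v ∈ σ
  · rw [hσ.2 w hw, (vertexPoint_supportedIn hσ.1 hv).2 w hw]; ring
  · rw [contractRatio_eq_zero (hσ.2 v hv), hσ.2 w hw]; ring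

theorem contract_zero (v : V) {ε : ℝ} (hε : 0 < ε) (f : Realization K) :
    contract v hε f 0 = f :=
  Realization.ext fun w => by simp [contract_coord, contractRatio]

theorem contract_one {v : V} {ε : ℝ} (hε : 0 < ε) {f : Realization K} (hf : ε ≤ f.coord v) :
    contract v hε f 1 = vertexPoint K v :=
  Realization.ext fun w => by
    have : min 1 (f.coord v / ε) = 1 := min_eq_left ((one_le_div hε).2 hf)
    simp [contract_coord, contractRatio, this]

theorem continuous_contract {Z : Type*} [TopologicalSpace Z] (v : V) {ε : ℝ} (hε : 0 < ε)
    {g : Z → Realization K} (hg : Continuous g) {s : Z → unitInterval} (hs : Continuous s) :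
    Continuous fun z => contract v hε (g z) (s z) := by
  have onFace : ∀ σ : K.faces, Continuous fun x : stdSimplex ℝ (σ : Finset V) × unitInterval =>
      contract v hε (faceMap K σ x.1) x.2 := by
    intro σ
    refine continuous_of_supportedIn
      (fun x => contract_supportedIn v hε (faceMap_supportedIn x.1) x.2) fun w _ => ?_
    have hc : ∀ u, Continuous fun x : stdSimplex ℝ (σ : Finset V) × unitInterval =>
        (faceMap K σ x.1).coord u := fun u =>
      (continuous_coord u).comp ((continuous_faceMap σ).comp continuous_fst)
    have hv := hc v
    have hw := hc w
    simp only [contract_coord, contractRatio]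
    fun_prop
  have onTime : ∀ f : Realization K, Continuous (contract v hε f) := by
    intro f
    obtain ⟨σ, hσ⟩ := f.exists_supportedIn
    have h := (onFace ⟨σ, hσ.1⟩).comp (Continuous.prodMk_right hσ.coords)
    simpa [Function.comp_def, faceMap_coords hσ] using h
  -- Joint continuity cannot be tested on faces directly, as the topology on the product with the
  -- interval is not given as a final one. Continuity into the space of paths can, and evaluation
  -- recovers the joint map.
  have hcurry : Continuous fun f : Realization K =>
      (⟨contract v hε f, onTime f⟩ : C(unitInterval, Realization K)) := by
    refine continuous_realization_iff.2 fun σ => ?_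
    exact (ContinuousMap.curry ⟨_, onFace σ⟩).continuous
  exact (hcurry.comp hg).eval hs

/-- Contracting `γ` to `v` sweeps out a square whose top side is constant and whose vertical sides
are the segments to `v`. -/
theorem mk_trans_segmentClass {v : V} {ε : ℝ} (hε : 0 < ε) {f g : Realization K} {γ : Path f g}
    (hγ : ∀ t, ε ≤ (γ t).coord v) {σ τ : Finset V} (hf : f.SupportedIn σ) (hg : g.SupportedIn τ)
    (hσ : (vertexPoint K v).SupportedIn σ) (hτ : (vertexPoint K v).SupportedIn τ) :
    (Path.Homotopic.Quotient.mk γ).trans (segmentClass hg hτ) = segmentClass hf hσ := by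
  have hf1 : ε ≤ f.coord v := by simpa using hγ 0
  have hg1 : ε ≤ g.coord v := by simpa using hγ 1
  let radial : ∀ k : Realization K, ε ≤ k.coord v → Path k (vertexPoint K v) := fun k hk =>
    { toFun := contract v hε k
      continuous_toFun := continuous_contract v hε continuous_const continuous_id
      source' := contract_zero v hε k
      target' := contract_one hε hk }
  have hrad : ∀ (k : Realization K) (hk : ε ≤ k.coord v) {ρ : Finset V} (h1 : k.SupportedIn ρ)
      (h2 : (vertexPoint K v).SupportedIn ρ), Path.Homotopic.Quotient.mk (radial k hk) =
        segmentClass h1 h2 :=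
    fun k hk ρ h1 h2 => Path.Homotopic.Quotient.eq.2 (homotopic_of_supportedIn (γ := radial k hk)
      (contract_supportedIn v hε h1) (segmentPath_supportedIn h1 h2))
  rw [← hrad f hf1, ← hrad g hg1]
  have := mk_trans_mk_of_square
    ⟨fun x => contract v hε (γ x.1) x.2,
      continuous_contract v hε (γ.continuous.comp continuous_fst) continuous_snd⟩
    γ (Path.refl (vertexPoint K v)) (radial f hf1) (radial g hg1)
    (fun t => contract_zero v hε _) (fun t => contract_one hε (hγ t))
    (fun s => by simp [radial]) (fun s => by simp [radial])
  rw [this, Path.Homotopic.Quotient.mk_refl, Path.Homotopic.Quotient.trans_refl]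

/-! ### Potentials -/

/-- A simplicial complex is simply connected if there are homotopy classes of paths from a base
vertex to all the vertices which are compatible with the edges. -/
theorem simplyConnectedSpace_of_potential (o : V)
    (g : ∀ v, Quotient (vertexPoint K o) (vertexPoint K v))
    (hg : ∀ σ (hσ : σ ∈ K.faces) (v) (hv : v ∈ σ) (w) (hw : w ∈ σ),
      (g v).trans (segmentClass (vertexPoint_supportedIn hσ hv)
        (vertexPoint_supportedIn hσ hw)) = g w) :
    SimplyConnectedSpace (Realization K) := by
  -- The potential extends to all points. A vertex with positive coordinate at `f` lies in every
  -- face supporting `f`, which makes the class independent of the face and vertex used.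
  have hG : ∀ f : Realization K, ∃ G : Quotient (vertexPoint K o) f,
      ∀ σ (hf : f.SupportedIn σ) (v) (hv : v ∈ σ),
        (g v).trans (segmentClass (vertexPoint_supportedIn hf.1 hv) hf) = G := by
    intro f
    obtain ⟨v₀, hv₀⟩ := f.exists_pos
    obtain ⟨σ₀, hσ₀⟩ := f.exists_supportedIn
    refine ⟨(g v₀).trans (segmentClass (vertexPoint_supportedIn hσ₀.1 (hσ₀.mem hv₀)) hσ₀),
      fun σ hf v hv => ?_⟩
    rw [← hg σ hf.1 v hv v₀ (hf.mem hv₀), Path.Homotopic.Quotient.trans_assoc]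
    exact congrArg _ (segmentClass_trans _ _ hf).symm
  choose G hG using hG
  have hstar : ∀ {v : V} {ε : ℝ} (_ : 0 < ε) {f f' : Realization K} (γ : Path f f')
      (_ : ∀ t, ε ≤ (γ t).coord v), (G f).trans (.mk γ) = G f' := by
    intro v ε hε f f' γ hγ
    obtain ⟨σ, hσ⟩ := f.exists_supportedIn
    obtain ⟨τ, hτ⟩ := f'.exists_supportedIn
    have hvσ : v ∈ σ := hσ.mem (hε.trans_le (by simpa using hγ 0))
    have hvτ : v ∈ τ := hτ.mem (hε.trans_le (by simpa using hγ 1))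
    have back : ∀ {k : Realization K} {ρ : Finset V} (hk : k.SupportedIn ρ) (hv : v ∈ ρ),
        (G k).trans (segmentClass hk (vertexPoint_supportedIn hk.1 hv)) = g v := by
      intro k ρ hk hv
      rw [← hG k ρ hk v hv, Path.Homotopic.Quotient.trans_assoc, segmentClass_trans,
        segmentClass_self, Path.Homotopic.Quotient.trans_refl]
    have h1 := mk_trans_segmentClass hε hγ hσ hτ (vertexPoint_supportedIn hσ.1 hvσ)
      (vertexPoint_supportedIn hτ.1 hvτ)
    have h2 : ((G f).trans (.mk γ)).trans
        (segmentClass hτ (vertexPoint_supportedIn hτ.1 hvτ)) =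
        (G f').trans (segmentClass hτ (vertexPoint_supportedIn hτ.1 hvτ)) := by
      rw [Path.Homotopic.Quotient.trans_assoc, h1, back hσ hvσ, back hτ hvτ]
    have h3 := congrArg (fun q => Path.Homotopic.Quotient.trans q
      (segmentClass (vertexPoint_supportedIn hτ.1 hvτ) hτ)) h2
    simpa only [Path.Homotopic.Quotient.trans_assoc, segmentClass_trans, segmentClass_self,
      Path.Homotopic.Quotient.trans_refl] using h3
  have hpath : ∀ {f f' : Realization K} (γ : Path f f'), (G f).trans (.mk γ) = G f' := by
    intro f f' γ
    -- `hstar` needs a uniform positive lower bound on a coordinate, so the open cover is indexed by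
    -- a vertex and a bound `1 / (n + 1)`, rather than by vertices alone.
    obtain ⟨t, ht0, hmono, ⟨N, hN⟩, hsub⟩ := exists_monotone_Icc_subset_open_cover_unitInterval
      (c := fun x : V × ℕ => {s | 1 / ((x.2 : ℝ) + 1) < (γ s).coord x.1})
      (fun x => isOpen_lt continuous_const ((continuous_coord _).comp γ.continuous))
      (fun s _ => by
        obtain ⟨v, hv⟩ := (γ s).exists_pos
        obtain ⟨n, hn⟩ := exists_nat_one_div_lt hv
        exact mem_iUnion.2 ⟨(v, n), hn⟩)
    have ind : ∀ n, (G (γ (t 0))).trans (.mk (γ.subpath (t 0) (t n))) = G (γ (t n)) := by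
      intro n
      induction n with
      | zero =>
        rw [Path.subpath_self, Path.Homotopic.Quotient.mk_refl,
          Path.Homotopic.Quotient.trans_refl]
      | succ n ih =>
        have h1 : Path.Homotopic.Quotient.mk (γ.subpath (t 0) (t (n + 1))) =
            (Path.Homotopic.Quotient.mk (γ.subpath (t 0) (t n))).trans
              (.mk (γ.subpath (t n) (t (n + 1)))) := by
          rw [← Path.Homotopic.Quotient.mk_trans]
          exact (Path.Homotopic.Quotient.eq.2
            ⟨Path.Homotopy.subpathTransSubpath γ (t 0) (t n) (t (n + 1))⟩).symm
        rw [h1, ← Path.Homotopic.Quotient.trans_assoc, ih]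
        obtain ⟨⟨v, m⟩, hvm⟩ := hsub n
        refine hstar (v := v) (ε := 1 / ((m : ℝ) + 1)) (by positivity) _ fun s => ?_
        have hmem : γ.subpath (t n) (t (n + 1)) s ∈ γ '' Icc (t n) (t (n + 1)) := by
          rw [← Path.range_subpath_of_le _ _ _ (hmono n.le_succ)]
          exact mem_range_self s
        obtain ⟨r, hr, hrs⟩ := hmem
        rw [← hrs]
        exact (hvm hr).le
    have h1 := ind N
    rw [ht0, hN N le_rfl, Path.subpath_zero_one] at h1
    have hcast : ∀ {a b : Realization K} (ha : a = f) (hb : b = f'),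
        (G a).trans (.mk (γ.cast ha hb)) = G b → (G f).trans (.mk γ) = G f' := by
      rintro _ _ rfl rfl h
      exact h
    exact hcast _ _ h1
  rw [simply_connected_iff_unique_homotopic]
  -- By `hpath`, every path class between two points is determined by the potential.
  refine ⟨⟨vertexPoint K o⟩, fun f f' => ⟨⟨⟨(G f).symm.trans (G f')⟩, fun q => ?_⟩⟩⟩
  obtain ⟨γ, rfl⟩ := Path.Homotopic.Quotient.mk_surjective q
  change _ = (G f).symm.trans (G f')
  rw [← hpath γ, ← Path.Homotopic.Quotient.trans_assoc, Path.Homotopic.Quotient.symm_trans,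
    Path.Homotopic.Quotient.refl_trans]

end Potentials

/-! ### Triangles, and the girth condition as a ban on short link cycles. -/

section Triangles

variable {V : Type u} {K : AbstractSimplicialComplex V}

/-- The vertices `a`, `b`, `c` span a triangle. -/
def Tri (K : AbstractSimplicialComplex V) (a b c : V) : Prop :=
  a ≠ b ∧ b ≠ c ∧ c ≠ a ∧ ∃ t ∈ K.faces, (t : Set V) = {a, b, c}

namespace Tri

theorem rotate {a b c : V} (h : Tri K a b c) : Tri K b c a := by
  obtain ⟨h1, h2, h3, t, ht, hs⟩ := h
  refine ⟨h2, h3, h1, t, ht, hs.trans ?_⟩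
  ext x; simp only [Set.mem_insert_iff, Set.mem_singleton_iff]; tauto

theorem swap {a b c : V} (h : Tri K a b c) : Tri K a c b := by
  obtain ⟨h1, h2, h3, t, ht, hs⟩ := h
  exact ⟨h3.symm, h2.symm, h1.symm, t, ht, hs.trans (by rw [Set.pair_comm])⟩

theorem adj {a b c : V} (h : Tri K a b c) : (oneSkeleton K).Adj a b := by
  classical
  obtain ⟨h1, h2, h3, t, ht, hs⟩ := h
  refine ⟨h1, {a, b}, (K.isRelLowerSet_faces ht).2 ?_ ⟨a, by simp⟩, by simp⟩
  intro x hx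
  rw [← Finset.mem_coe, hs]
  simp only [Finset.mem_insert, Finset.mem_singleton] at hx
  rcases hx with rfl | rfl <;> simp

theorem adj' {a b c : V} (h : Tri K a b c) : (oneSkeleton K).Adj a c := h.swap.adj

end Tri

theorem adj_of_mem_face {σ : Finset V} (hσ : σ ∈ K.faces) {a b : V} (ha : a ∈ σ) (hb : b ∈ σ)
    (hab : a ≠ b) : (oneSkeleton K).Adj a b := by
  classical
  refine ⟨hab, {a, b}, (K.isRelLowerSet_faces hσ).2 ?_ ⟨a, by simp⟩, by simp⟩
  intro x hx
  simp only [Finset.mem_insert, Finset.mem_singleton] at hx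
  rcases hx with rfl | rfl <;> assumption

theorem tri_of_mem_face {σ : Finset V} (hσ : σ ∈ K.faces) {a b c : V} (ha : a ∈ σ) (hb : b ∈ σ)
    (hc : c ∈ σ) (hab : a ≠ b) (hbc : b ≠ c) (hca : c ≠ a) : Tri K a b c := by
  classical
  refine ⟨hab, hbc, hca, {a, b, c}, (K.isRelLowerSet_faces hσ).2 ?_ ⟨a, by simp⟩, by simp⟩
  intro x hx
  simp only [Finset.mem_insert, Finset.mem_singleton] at hx
  rcases hx with rfl | rfl | rfl <;> assumption

/-- The link of no vertex contains a cycle of length less than `6`. -/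
structure LargeLinks (K : AbstractSimplicialComplex V) : Prop where
  no_three : ∀ {v a b c : V}, Tri K v a b → Tri K v b c → Tri K v c a → False
  no_four : ∀ {v a b c d : V}, Tri K v a b → Tri K v b c → Tri K v c d → Tri K v d a →
    a ≠ c → b ≠ d → False
  no_five : ∀ {v a b c d e : V}, Tri K v a b → Tri K v b c → Tri K v c d → Tri K v d e →
    Tri K v e a → a ≠ c → b ≠ d → c ≠ e → d ≠ a → e ≠ b → False

theorem link_adj_of_tri {v a b : V} (h : Tri K v a b) :
    (link K v).Adj ⟨a, h.adj⟩ ⟨b, h.adj'⟩ :=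
  ⟨fun hab => h.2.1 (congrArg Subtype.val hab), h.2.2.2⟩

theorem no_three_cycle {W : Type*} {G : SimpleGraph W} (hG : 6 ≤ G.egirth)
    {a b c : W} (h1 : G.Adj a b) (h2 : G.Adj b c) (h3 : G.Adj c a) : False := by
  have hc : (SimpleGraph.Walk.cons h1 (.cons h2 (.cons h3 .nil))).IsCycle := by
    simp [SimpleGraph.Walk.cons_isCycle_iff, SimpleGraph.Walk.cons_isPath_iff,
      h1.ne, h2.ne, h3.ne, h1.ne.symm, h3.ne.symm]
  have := hG.trans (SimpleGraph.egirth_le_length hc)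
  simp at this
  exact absurd this (by decide)

theorem no_four_cycle {W : Type*} {G : SimpleGraph W} (hG : 6 ≤ G.egirth)
    {a b c d : W} (h1 : G.Adj a b) (h2 : G.Adj b c) (h3 : G.Adj c d) (h4 : G.Adj d a)
    (hac : a ≠ c) (hbd : b ≠ d) : False := by
  have hc : (SimpleGraph.Walk.cons h1 (.cons h2 (.cons h3 (.cons h4 .nil)))).IsCycle := by
    simp [SimpleGraph.Walk.cons_isCycle_iff, SimpleGraph.Walk.cons_isPath_iff,
      h1.ne, h2.ne, h3.ne, h4.ne, hac, hbd, h1.ne.symm, h4.ne.symm, hac.symm]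
  have := hG.trans (SimpleGraph.egirth_le_length hc)
  simp at this
  exact absurd this (by decide)

theorem no_five_cycle {W : Type*} {G : SimpleGraph W} (hG : 6 ≤ G.egirth)
    {a b c d e : W} (h1 : G.Adj a b) (h2 : G.Adj b c) (h3 : G.Adj c d) (h4 : G.Adj d e)
    (h5 : G.Adj e a) (hac : a ≠ c) (hbd : b ≠ d) (hce : c ≠ e) (hda : d ≠ a) (heb : e ≠ b) :
    False := by
  have hc : (SimpleGraph.Walk.cons h1
      (.cons h2 (.cons h3 (.cons h4 (.cons h5 .nil))))).IsCycle := by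
    simp [SimpleGraph.Walk.cons_isCycle_iff, SimpleGraph.Walk.cons_isPath_iff,
      h1.ne, h2.ne, h3.ne, h4.ne, h5.ne, hac, hbd, hce, hda, h1.ne.symm, h5.ne.symm,
      hac.symm, hda.symm, heb.symm]
  have := hG.trans (SimpleGraph.egirth_le_length hc)
  simp at this
  exact absurd this (by decide)

theorem largeLinks_of_six_le_egirth (h : ∀ v, 6 ≤ (link K v).egirth) : LargeLinks K where
  no_three h1 h2 h3 :=
    no_three_cycle (h _) (link_adj_of_tri h1) (link_adj_of_tri h2) (link_adj_of_tri h3)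
  no_four h1 h2 h3 h4 hac hbd :=
    no_four_cycle (h _) (link_adj_of_tri h1) (link_adj_of_tri h2) (link_adj_of_tri h3)
      (link_adj_of_tri h4) (fun e => hac (congrArg Subtype.val e))
      (fun e => hbd (congrArg Subtype.val e))
  no_five h1 h2 h3 h4 h5 hac hbd hce hda heb :=
    no_five_cycle (h _) (link_adj_of_tri h1) (link_adj_of_tri h2) (link_adj_of_tri h3)
      (link_adj_of_tri h4) (link_adj_of_tri h5) (fun e => hac (congrArg Subtype.val e))
      (fun e => hbd (congrArg Subtype.val e)) (fun e => hce (congrArg Subtype.val e))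
      (fun e => hda (congrArg Subtype.val e)) (fun e => heb (congrArg Subtype.val e))

end Triangles

/-! ### Construction of the universal cover, sphere by sphere. -/

section Tower

variable {V : Type u} {K : AbstractSimplicialComplex V}

/-- A candidate for a sphere around the base point of the universal cover of `K`: a set `S` of
vertices lying over the vertices of `K` via `p`. The neighbours of `s` in the previous sphere lie
over `D s`, and `H` is the adjacency inside the sphere. -/
structure Level (K : AbstractSimplicialComplex V) where
  S : Type u
  p : S → V
  D : S → Set V
  H : S → S → Prop
  adj_of_mem : ∀ {s u}, u ∈ D s → (oneSkeleton K).Adj (p s) u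
  tri_of_mem : ∀ {s u u'}, u ∈ D s → u' ∈ D s → u ≠ u' → Tri K (p s) u u'
  H_symm : ∀ {s s'}, H s s' → H s' s
  H_tri : ∀ {s s'}, H s s' → ∃ u ∈ D s, u ∈ D s' ∧ Tri K (p s) (p s') u
  H_notMem : ∀ {s s'}, H s s' → p s' ∉ D s
  H_exists : ∀ {s u w}, u ∈ D s → Tri K (p s) u w → w ∉ D s → ∃ s', H s s' ∧ p s' = w
  H_unique : ∀ {s s' s''}, H s s' → H s s'' → p s' = p s'' → s' = s''

namespace Level

variable {L : Level K}

/-- The neighbour `z` of `p s` lies over a neighbour of `s` in the next sphere. -/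
structure Up (L : Level K) (s : L.S) (z : V) : Prop where
  adj : (oneSkeleton K).Adj (L.p s) z
  notMem : z ∉ L.D s
  not_tri : ∀ u ∈ L.D s, ¬ Tri K (L.p s) u z

theorem H_ne {s s' : L.S} (h : L.H s s') : L.p s ≠ L.p s' := by
  obtain ⟨u, -, -, ht⟩ := L.H_tri h
  exact ht.1

/-- Otherwise `z`, `s'`, `s''` and the parents that `s` shares with `s'` and with `s''` form a cycle
of length 4 or 5 in the link of `p s`. -/
theorem eq_of_H_of_tri (hK : LargeLinks K) {s s' s'' : L.S} {z : V} (h' : L.H s s')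
    (h'' : L.H s s'') (hz : z ∉ L.D s) (t' : Tri K (L.p s) (L.p s') z)
    (t'' : Tri K (L.p s) (L.p s'') z) : s' = s'' := by
  refine L.H_unique h' h'' ?_
  by_contra hne
  obtain ⟨u', hu', -, r'⟩ := L.H_tri h'
  obtain ⟨u'', hu'', -, r''⟩ := L.H_tri h''
  have hzu' : z ≠ u' := fun h => hz (h ▸ hu')
  have hzu'' : z ≠ u'' := fun h => hz (h ▸ hu'')
  by_cases huu : u' = u''
  · subst huu
    exact hK.no_four t'.swap r' r''.swap t'' hzu' hne
  · exact hK.no_five t'.swap r' (L.tri_of_mem hu' hu'' huu) r''.swap t'' hzu'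
      (fun h => L.H_notMem h' (h ▸ hu'')) (fun h => L.H_notMem h'' (h ▸ hu')) hzu''.symm
      (fun h => hne h.symm)

/-- Together with the shared parents, such a triangle closes a cycle of length 3 or 4 in the link of
`p s`. -/
theorem not_tri_of_H_of_H (hK : LargeLinks K) {s s' s'' : L.S} (h' : L.H s s')
    (h'' : L.H s s'') : ¬ Tri K (L.p s) (L.p s') (L.p s'') := by
  intro t
  obtain ⟨u', hu', -, r'⟩ := L.H_tri h'
  obtain ⟨u'', hu'', -, r''⟩ := L.H_tri h''
  by_cases huu : u' = u''
  · subst huu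
    exact hK.no_three t r'' r'.swap
  · exact hK.no_four t r'' (L.tri_of_mem hu'' hu' (Ne.symm huu)) r'.swap
      (fun h => L.H_notMem h' (h ▸ hu'')) (fun h => L.H_notMem h'' (h ▸ hu'))

/-- In the link of `p s'`, the path from `z` through `p s` to a shared parent would be closed up to
length 3 or 4 if `z` were a parent of `s'` or adjacent there to one. -/
theorem Up.of_H (hK : LargeLinks K) {s s' : L.S} {z : V} (hz : L.Up s z) (h : L.H s s')
    (t : Tri K (L.p s) (L.p s') z) : L.Up s' z := by
  obtain ⟨u₀, hu₀, hu₀', r⟩ := L.H_tri h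
  have r' : Tri K (L.p s') (L.p s) u₀ := r.rotate.swap
  have t' : Tri K (L.p s') z (L.p s) := t.rotate
  have hzu : z ≠ u₀ := fun e => hz.notMem (e ▸ hu₀)
  refine ⟨t'.adj, fun hm => ?_, fun u hu tu => ?_⟩
  · exact hK.no_three t' r' (L.tri_of_mem hu₀' hm hzu.symm)
  · by_cases huu : u = u₀
    · subst huu
      exact hK.no_three t' r' tu
    · exact hK.no_four t' r' (L.tri_of_mem hu₀' hu (Ne.symm huu)) tu hzu
        (fun e => L.H_notMem (L.H_symm h) (e ▸ hu))

/-- Identification of the neighbours in the next sphere of adjacent vertices of a sphere. -/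
def nextSetoid (hK : LargeLinks K) (L : Level K) : Setoid {x : L.S × V // L.Up x.1 x.2} where
  r x y := x.1.2 = y.1.2 ∧
    (x.1.1 = y.1.1 ∨ L.H x.1.1 y.1.1 ∧ Tri K (L.p x.1.1) (L.p y.1.1) x.1.2)
  iseqv :=
    { refl := fun x => ⟨rfl, Or.inl rfl⟩
      symm := by
        rintro x y ⟨h, h' | ⟨h', t⟩⟩
        · exact ⟨h.symm, Or.inl h'.symm⟩
        · exact ⟨h.symm, Or.inr ⟨L.H_symm h', h ▸ t.rotate.swap⟩⟩
      trans := by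
        rintro ⟨⟨s, z⟩, hs⟩ ⟨⟨s', z'⟩, hs'⟩ ⟨⟨s'', z''⟩, hs''⟩ ⟨h1, h2⟩ ⟨h3, h4⟩
        dsimp only at h1 h2 h3 h4 hs hs' hs''
        subst h1 h3
        refine ⟨rfl, ?_⟩
        dsimp only
        rcases h2 with rfl | ⟨h2, t2⟩
        · exact h4
        rcases h4 with rfl | ⟨h4, t4⟩
        · exact Or.inr ⟨h2, t2⟩
        -- Both outer vertices are horizontal neighbours of `s'` forming a triangle with `z`, so
        -- they coincide: a vertex of the next sphere has at most two parents.
        · exact Or.inl (eq_of_H_of_tri hK (L.H_symm h2) h4 hs'.notMem t2.rotate.swap t4) }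

/-- `x` is a neighbour of `s` in the next sphere. -/
def Par (hK : LargeLinks K) (L : Level K) (x : Quotient (nextSetoid hK L)) (s : L.S) : Prop :=
  ∃ (z : V) (h : L.Up s z), x = Quotient.mk _ ⟨(s, z), h⟩

/-- The vertex under a vertex of the next sphere. -/
def nextProj (hK : LargeLinks K) (L : Level K) : Quotient (nextSetoid hK L) → V :=
  Quotient.lift (fun x => x.1.2) fun _ _ h => h.1

variable {hK : LargeLinks K}

theorem Par.up {x : Quotient (nextSetoid hK L)} {s : L.S} (h : Par hK L x s) :
    L.Up s (nextProj hK L x) := by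
  obtain ⟨z, hz, rfl⟩ := h
  exact hz

theorem Par.eq_of_proj_eq {x y : Quotient (nextSetoid hK L)} {s : L.S} (hx : Par hK L x s)
    (hy : Par hK L y s) (h : nextProj hK L x = nextProj hK L y) : x = y := by
  obtain ⟨z, hz, rfl⟩ := hx
  obtain ⟨w, hw, rfl⟩ := hy
  obtain rfl : z = w := h
  rfl

theorem par_mk {s : L.S} {z : V} (h : L.Up s z) :
    Par hK L (Quotient.mk _ ⟨(s, z), h⟩) s := ⟨z, h, rfl⟩

theorem exists_par (x : Quotient (nextSetoid hK L)) : ∃ s, Par hK L x s := by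
  obtain ⟨⟨⟨s, z⟩, h⟩, rfl⟩ := Quotient.exists_rep x
  exact ⟨s, par_mk h⟩

theorem Par.cases {x : Quotient (nextSetoid hK L)} {s s' : L.S} (h : Par hK L x s)
    (h' : Par hK L x s') :
    s = s' ∨ L.H s s' ∧ Tri K (L.p s) (L.p s') (nextProj hK L x) := by
  obtain ⟨z, hz, rfl⟩ := h
  obtain ⟨w, hw, e⟩ := h'
  exact (Quotient.exact e).2

theorem Par.of_H {x : Quotient (nextSetoid hK L)} {s s' : L.S} (h : Par hK L x s)
    (h' : L.H s s') (t : Tri K (L.p s) (L.p s') (nextProj hK L x)) : Par hK L x s' := by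
  obtain ⟨z, hz, rfl⟩ := h
  exact ⟨z, hz.of_H hK h' t, Quotient.sound ⟨rfl, Or.inr ⟨h', t⟩⟩⟩

theorem Par.eq_of_p_eq {x : Quotient (nextSetoid hK L)} {s s' : L.S} (h : Par hK L x s)
    (h' : Par hK L x s') (e : L.p s = L.p s') : s = s' :=
  (h.cases h').resolve_right fun hh => H_ne hh.1 e

/-- Two vertices of the next sphere which span a triangle with a vertex of the sphere. -/
def NextH (hK : LargeLinks K) (L : Level K) (x y : Quotient (nextSetoid hK L)) : Prop :=
  ∃ s, Par hK L x s ∧ Par hK L y s ∧ Tri K (L.p s) (nextProj hK L x) (nextProj hK L y)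

/-- Distinct parents of `x` are adjacent in its link, so a common neighbour `w` there would close a
3-cycle. -/
theorem par_eq_of_tri {x : Quotient (nextSetoid hK L)} {s s' : L.S} {w : V}
    (h : Par hK L x s) (h' : Par hK L x s') (t : Tri K (nextProj hK L x) (L.p s) w)
    (t' : Tri K (nextProj hK L x) (L.p s') w) : s = s' := by
  refine (h.cases h').resolve_right fun hh => ?_
  exact hK.no_three hh.2.rotate.rotate t' t.swap

/-- The next sphere. -/
def next (hK : LargeLinks K) (L : Level K) : Level K where
  S := Quotient (nextSetoid hK L)
  p := nextProj hK L
  D x := {u | ∃ s, Par hK L x s ∧ L.p s = u}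
  H := NextH hK L
  adj_of_mem := by
    rintro x _ ⟨s, h, rfl⟩
    exact h.up.adj.symm
  tri_of_mem := by
    rintro x _ _ ⟨s, h, rfl⟩ ⟨s', h', rfl⟩ hne
    exact ((h.cases h').resolve_left fun e => hne (e ▸ rfl)).2.rotate.rotate
  H_symm := by
    rintro x y ⟨s, hx, hy, t⟩
    exact ⟨s, hy, hx, t.swap⟩
  H_tri := by
    rintro x y ⟨s, hx, hy, t⟩
    exact ⟨L.p s, ⟨s, hx, rfl⟩, ⟨s, hy, rfl⟩, t.rotate⟩
  H_notMem := by
    rintro x y ⟨s, hx, hy, t⟩ ⟨s', hx', e⟩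
    rcases hx.cases hx' with rfl | ⟨h, -⟩
    · exact t.2.2.1 e.symm
    · obtain ⟨u, hu, -, r⟩ := L.H_tri h
      exact hy.up.not_tri u hu (e ▸ r.swap)
  H_exists := by
    rintro x _ w ⟨s, h, rfl⟩ t hw
    have hup : L.Up s w := by
      refine ⟨t.rotate.adj, fun hm => h.up.not_tri w hm t.rotate, fun u hu r => ?_⟩
      -- If `w` were adjacent in the link of `p s` to a parent of `s`, it would lie under a
      -- horizontal neighbour of `s`; that neighbour would be a parent of `x`, contrary to `hw`.
      have hwD : w ∉ L.D s := fun hm => h.up.not_tri w hm t.rotate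
      obtain ⟨s', hs', rfl⟩ := L.H_exists hu r hwD
      exact hw ⟨s', h.of_H hs' t.rotate, rfl⟩
    exact ⟨_, ⟨s, h, par_mk hup, t.rotate.swap⟩, rfl⟩
  H_unique := by
    rintro x y y' ⟨s, hx, hy, t⟩ ⟨s', hx', hy', t'⟩ e
    obtain rfl : s = s' := par_eq_of_tri hx hx' t.swap.rotate.rotate
      (e ▸ t'.swap.rotate.rotate)
    exact hy.eq_of_proj_eq hy' e

/-- The sphere of radius `0`. -/
def zero (K : AbstractSimplicialComplex V) (o : V) : Level K where
  S := PUnit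
  p _ := o
  D _ := ∅
  H _ _ := False
  adj_of_mem h := h.elim
  tri_of_mem h := h.elim
  H_symm h := h
  H_tri h := h.elim
  H_notMem h := h.elim
  H_exists h := h.elim
  H_unique h := h.elim

/-- The spheres around the base point of the universal cover. -/
def sphere (hK : LargeLinks K) (o : V) : ℕ → Level K
  | 0 => zero K o
  | n + 1 => next hK (sphere hK o n)

end Level

open Level

/-- The vertices of the universal cover. -/
def CoverVertex (hK : LargeLinks K) (o : V) : Type u := Σ n : ℕ, (sphere hK o n).S

/-- The covering projection on vertices. -/
def coverProj (hK : LargeLinks K) (o : V) (x : CoverVertex hK o) : V := (sphere hK o x.1).p x.2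

/-- `s` is a neighbour of `x` in the previous sphere. -/
def IsParent (hK : LargeLinks K) (o : V) (n : ℕ) (x : (sphere hK o (n + 1)).S)
    (s : (sphere hK o n).S) : Prop :=
  Par hK (sphere hK o n) x s

/-- Equality or adjacency of vertices of the universal cover. -/
inductive Move (hK : LargeLinks K) (o : V) : CoverVertex hK o → CoverVertex hK o → Prop
  | refl (x) : Move hK o x x
  | down {n : ℕ} {x : (sphere hK o (n + 1)).S} {s : (sphere hK o n).S}
      (h : IsParent hK o n x s) : Move hK o ⟨n + 1, x⟩ ⟨n, s⟩
  | up {n : ℕ} {x : (sphere hK o (n + 1)).S} {s : (sphere hK o n).S}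
      (h : IsParent hK o n x s) : Move hK o ⟨n, s⟩ ⟨n + 1, x⟩
  | horiz {n : ℕ} {s s' : (sphere hK o n).S} (h : (sphere hK o n).H s s') :
      Move hK o ⟨n, s⟩ ⟨n, s'⟩

variable {hK : LargeLinks K} {o : V}

theorem Move.symm {x y : CoverVertex hK o} (h : Move hK o x y) : Move hK o y x := by
  cases h with
  | refl => exact .refl _
  | down h => exact .up h
  | up h => exact .down h
  | horiz h => exact .horiz ((sphere hK o _).H_symm h)

theorem IsParent.mem {n : ℕ} {x : (sphere hK o (n + 1)).S} {s : (sphere hK o n).S}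
    (h : IsParent hK o n x s) : (sphere hK o n).p s ∈ (sphere hK o (n + 1)).D x :=
  ⟨s, h, rfl⟩

theorem IsParent.up {n : ℕ} {x : (sphere hK o (n + 1)).S} {s : (sphere hK o n).S}
    (h : IsParent hK o n x s) : (sphere hK o n).Up s ((sphere hK o (n + 1)).p x) :=
  Par.up h

theorem not_up_of_H {L : Level K} {s s' : L.S} (h : L.H s s') : ¬ L.Up s (L.p s') := by
  intro hup
  obtain ⟨u, hu, -, r⟩ := L.H_tri h
  exact hup.not_tri u hu r.swap

/-- Neighbours below, beside and above `x` lie over disjoint sets of vertices of `K`, and within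
each kind the projection is injective. -/
theorem Move.unique {x y z : CoverVertex hK o} (hy : Move hK o x y) (hz : Move hK o x z)
    (e : coverProj hK o y = coverProj hK o z) : y = z := by
  cases hy with
  | refl =>
    cases hz with
    | refl => rfl
    | down h => exact absurd e ((sphere hK o _).adj_of_mem h.mem).ne
    | up h => exact absurd e h.up.adj.ne
    | horiz h => exact absurd e (H_ne h)
  | down hd =>
    cases hz with
    | refl => exact absurd e ((sphere hK o _).adj_of_mem hd.mem).ne'
    | down h => rw [Par.eq_of_p_eq hd h e]
    | up h => exact absurd ((congrArg (· ∈ _) e).mp hd.mem) h.up.notMem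
    | horiz h => exact absurd ((congrArg (· ∈ _) e).mp hd.mem) ((sphere hK o _).H_notMem h)
  | up hu =>
    cases hz with
    | refl => exact absurd e hu.up.adj.ne'
    | down h => exact absurd ((congrArg (· ∈ _) e).mpr h.mem) hu.up.notMem
    | up h => rw [Par.eq_of_proj_eq hu h e]
    | horiz h => exact absurd ((congrArg (Up _ _) e).mp hu.up) (not_up_of_H h)
  | horiz hh =>
    cases hz with
    | refl => exact absurd e (H_ne hh).symm
    | down h => exact absurd ((congrArg (· ∈ _) e).mpr h.mem) ((sphere hK o _).H_notMem hh)
    | up h => exact absurd ((congrArg (Up _ _) e).mpr h.up) (not_up_of_H hh)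
    | horiz h => rw [(sphere hK o _).H_unique hh h e]

/-- Triangles lift. The level patterns that would violate this, one neighbour below and one above or
two distinct horizontal ones, cannot span a triangle with `x`. -/
theorem Move.of_tri {x y z : CoverVertex hK o} (hy : Move hK o x y) (hz : Move hK o x z)
    (t : Tri K (coverProj hK o x) (coverProj hK o y) (coverProj hK o z)) : Move hK o y z := by
  cases hy with
  | refl => exact hz
  | down hd =>
    cases hz with
    | refl => exact .up hd
    | down h =>
      rcases Par.cases hd h with rfl | ⟨hh, -⟩
      · exact .refl _
      · exact .horiz hh
    | up h => exact absurd t (h.up.not_tri _ hd.mem)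
    | horiz h =>
      obtain ⟨s, h1, h2, t'⟩ := h
      obtain rfl := par_eq_of_tri hd h1 t t'.swap.rotate.rotate
      exact .up h2
  | up hu =>
    cases hz with
    | refl => exact .down hu
    | down h => exact absurd t.swap (hu.up.not_tri _ h.mem)
    | up h => exact .horiz ⟨_, hu, h, t⟩
    | horiz h => exact .down (Par.of_H hu h t.swap)
  | horiz hh =>
    cases hz with
    | refl => exact .horiz ((sphere hK o _).H_symm hh)
    | down h =>
      obtain ⟨s, h1, h2, t'⟩ := hh
      obtain rfl := par_eq_of_tri h h1 t.swap t'.swap.rotate.rotate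
      exact .down h2
    | up h => exact .up (Par.of_H h hh t)
    | horiz h => exact absurd t (not_tri_of_H_of_H hK hh h)

/-- A neighbour of the projection is a parent, or adjacent in the link to a parent (hence horizontal
by `H_exists`), or neither, which is `Up`. -/
theorem Move.exists_of_adj (x : CoverVertex hK o) {w : V}
    (hw : (oneSkeleton K).Adj (coverProj hK o x) w) :
    ∃ y, coverProj hK o y = w ∧ Move hK o x y := by
  obtain ⟨n, s⟩ := x
  by_cases hD : w ∈ (sphere hK o n).D s
  · cases n with
    | zero => exact hD.elim
    | succ n =>
      obtain ⟨s', h, rfl⟩ := hD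
      exact ⟨⟨n, s'⟩, rfl, .down h⟩
  · by_cases hN : ∃ u ∈ (sphere hK o n).D s, Tri K ((sphere hK o n).p s) u w
    · obtain ⟨u, hu, t⟩ := hN
      obtain ⟨s', h, rfl⟩ := (sphere hK o n).H_exists hu t hD
      exact ⟨⟨n, s'⟩, rfl, .horiz h⟩
    · have hup : (sphere hK o n).Up s w := ⟨hw, hD, fun u hu t => hN ⟨u, hu, t⟩⟩
      exact ⟨⟨n + 1, Quotient.mk _ ⟨(s, w), hup⟩⟩, rfl, .up (par_mk hup)⟩

theorem Move.proj_ne {x y : CoverVertex hK o} (h : Move hK o x y) (hne : x ≠ y) :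
    coverProj hK o x ≠ coverProj hK o y :=
  fun e => hne (Move.unique (.refl x) h e)

theorem isLocalSystem_move (hK : LargeLinks K) (o : V) :
    IsLocalSystem K (coverProj hK o) (Move hK o) where
  refl := .refl
  symm := Move.symm
  trans := by
    intro x y z σ hσ hx hy hz hxy hyz
    by_cases h1 : x = y
    · exact h1 ▸ hyz
    by_cases h2 : y = z
    · exact h2 ▸ hxy
    by_cases h3 : x = z
    · exact h3 ▸ .refl x
    have h3' : coverProj hK o z ≠ coverProj hK o x := fun e => h3 (hxy.symm.unique hyz e.symm)
    exact hxy.symm.of_tri hyz (tri_of_mem_face hσ hy hx hz (hxy.symm.proj_ne (Ne.symm h1))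
      h3'.symm (hyz.proj_ne h2).symm)
  exists_lift := by
    intro x w σ hσ hx hw
    by_cases h : coverProj hK o x = w
    · exact ⟨x, h, .refl x⟩
    · exact Move.exists_of_adj x (adj_of_mem_face hσ hx hw h)
  unique := Move.unique

end Tower

/-! ### The metric spheres of a two-dimensional systolic complex. -/

section Layers

variable {V : Type u} {K : AbstractSimplicialComplex V}

open Level

section CoverVertices

variable {hK : LargeLinks K} {o : V}

theorem Move.level_le {x y : CoverVertex hK o} (h : Move hK o x y) : x.1 ≤ y.1 + 1 := by
  cases h <;> (simp; try omega)

theorem Move.mem_of_level {x y : CoverVertex hK o} (h : Move hK o x y) (hl : y.1 + 1 = x.1) :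
    coverProj hK o y ∈ (sphere hK o x.1).D x.2 := by
  cases h with
  | refl => simp at hl
  | down h => exact h.mem
  | up h => simp at hl; omega
  | horiz h => simp at hl

theorem Move.tri_of_level {x y : CoverVertex hK o} (h : Move hK o x y) (hne : x ≠ y)
    (hl : x.1 = y.1) : ∃ u ∈ (sphere hK o x.1).D x.2,
      Tri K (coverProj hK o x) (coverProj hK o y) u := by
  cases h with
  | refl => exact absurd rfl hne
  | down h => simp at hl
  | up h => simp at hl
  | horiz h =>
    obtain ⟨u, hu, -, t⟩ := (sphere hK o _).H_tri h
    exact ⟨u, hu, t⟩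

theorem exists_move_of_mem {x : CoverVertex hK o} {u : V}
    (hu : u ∈ (sphere hK o x.1).D x.2) :
    ∃ y, Move hK o x y ∧ coverProj hK o y = u ∧ y.1 + 1 = x.1 := by
  obtain ⟨n, s⟩ := x
  cases n with
  | zero => exact hu.elim
  | succ n =>
    obtain ⟨s', h, rfl⟩ := hu
    exact ⟨⟨n, s'⟩, .down h, rfl, rfl⟩

theorem exists_move_of_level_ne_zero {x : CoverVertex hK o} (hx : x.1 ≠ 0) :
    ∃ u, u ∈ (sphere hK o x.1).D x.2 := by
  obtain ⟨n, s⟩ := x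
  cases n with
  | zero => exact absurd rfl hx
  | succ n =>
    obtain ⟨s', h⟩ := exists_par (hK := hK) s
    exact ⟨_, s', h, rfl⟩

theorem coverProj_of_level_eq_zero {x : CoverVertex hK o} (hx : x.1 = 0) :
    coverProj hK o x = o := by
  obtain ⟨n, s⟩ := x
  obtain rfl : n = 0 := hx
  rfl

end CoverVertices

/-- The structure of the metric spheres around `o` in a two-dimensional systolic complex, `d`
being the distance from `o`. -/
structure IsLayered (K : AbstractSimplicialComplex V) (o : V) (d : V → ℕ) : Prop where
  eq_zero_iff : ∀ {v}, d v = 0 ↔ v = o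
  le_of_adj : ∀ {v w}, (oneSkeleton K).Adj v w → d v ≤ d w + 1
  exists_down : ∀ {v}, d v ≠ 0 → ∃ u, (oneSkeleton K).Adj v u ∧ d u + 1 = d v
  tri_of_down : ∀ {v u u'}, (oneSkeleton K).Adj v u → (oneSkeleton K).Adj v u' →
    d u + 1 = d v → d u' + 1 = d v → u ≠ u' → Tri K v u u'
  exists_tri : ∀ {v w}, (oneSkeleton K).Adj v w → d v = d w → ∃ u, Tri K v w u ∧ d u + 1 = d v

/-- The local system has a section through the base vertex; `d` is its level. Unique lifting keeps
the parents of `s v` on the section, so the structure of the spheres passes to `K`. -/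
theorem exists_isLayered [SimplyConnectedSpace (Realization K)] (hK : LargeLinks K) (o : V) :
    ∃ d, IsLayered K o d := by
  obtain ⟨s, hs, hso, hmove⟩ := (isLocalSystem_move hK o).exists_section ⟨0, PUnit.unit⟩
  replace hso : s o = ⟨0, PUnit.unit⟩ := hso
  have hadj : ∀ {v w}, (oneSkeleton K).Adj v w → Move hK o (s v) (s w) := by
    rintro v w ⟨-, t, ht, hvw⟩
    refine hmove t ht v ?_ w ?_ <;> rw [← Finset.mem_coe, hvw] <;> simp
  have hinj : ∀ {v w}, v ≠ w → s v ≠ s w := fun {v w} h e =>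
    h ((hs v).symm.trans ((congrArg (coverProj hK o) e).trans (hs w)))
  have hmem : ∀ {v u}, u ∈ (sphere hK o (s v).1).D (s v).2 →
      (oneSkeleton K).Adj v u ∧ (s u).1 + 1 = (s v).1 := by
    intro v u hu
    have hvu : (oneSkeleton K).Adj v u := by
      have := (sphere hK o (s v).1).adj_of_mem hu
      rwa [show (sphere hK o (s v).1).p (s v).2 = v from hs v] at this
    obtain ⟨y, hy, rfl, hl⟩ := exists_move_of_mem hu
    rw [(hadj hvu).unique hy (hs _)]
    exact ⟨hvu, hl⟩
  refine ⟨fun v => (s v).1, ⟨?_, fun h => (hadj h).level_le, ?_, ?_, ?_⟩⟩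
  · intro v
    refine ⟨fun h => ?_, ?_⟩
    · rw [← hs v]
      exact coverProj_of_level_eq_zero h
    · rintro rfl
      rw [hso]
  · intro v hv
    obtain ⟨u, hu⟩ := exists_move_of_level_ne_zero hv
    exact ⟨u, hmem hu⟩
  · intro v u u' h h' hd hd' hne
    have m := (hadj h).mem_of_level hd
    have m' := (hadj h').mem_of_level hd'
    rw [hs] at m m'
    have := (sphere hK o (s v).1).tri_of_mem m m' hne
    rwa [show (sphere hK o (s v).1).p (s v).2 = v from hs v] at this
  · intro v w h hd
    obtain ⟨u, hu, t⟩ := (hadj h).tri_of_level (hinj h.ne) hd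
    rw [hs, hs] at t
    exact ⟨u, t, (hmem hu).2⟩

theorem IsLayered.exists_walk {o : V} {d : V → ℕ} (h : IsLayered K o d) :
    ∀ n v, d v = n → ∃ p : (oneSkeleton K).Walk o v, p.length = n := by
  intro n
  induction n with
  | zero =>
    intro v hv
    obtain rfl := h.eq_zero_iff.1 hv
    exact ⟨.nil, rfl⟩
  | succ n ih =>
    intro v hv
    obtain ⟨u, hvu, hu⟩ := h.exists_down (v := v) (by omega)
    obtain ⟨p, hp⟩ := ih u (by omega)
    exact ⟨p.concat hvu.symm, by rw [SimpleGraph.Walk.length_concat, hp]⟩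

theorem IsLayered.le_add_length {o : V} {d : V → ℕ} (h : IsLayered K o d) {v w : V}
    (p : (oneSkeleton K).Walk v w) : d w ≤ d v + p.length := by
  induction p with
  | nil => simp
  | cons hvw p ih =>
    have := h.le_of_adj hvw.symm
    rw [SimpleGraph.Walk.length_cons]
    omega

/-- A function vanishing only at `o`, changing by at most 1 along edges, and admitting a descending
edge elsewhere is the distance. The descending walk also supplies reachability, without which `dist`
would default to 0. -/
theorem IsLayered.eq_dist {o : V} {d : V → ℕ} (h : IsLayered K o d) :
    d = (oneSkeleton K).dist o := by
  funext v
  obtain ⟨p, hp⟩ := h.exists_walk _ v rfl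
  refine le_antisymm ?_ (hp ▸ SimpleGraph.dist_le p)
  obtain ⟨q, hq⟩ := p.reachable.exists_walk_length_eq_dist
  have := h.le_add_length q
  rw [h.eq_zero_iff.2 rfl] at this
  omega

theorem IsTwoDimSystolic.isLayered (h : IsTwoDimSystolic K) (o : V) :
    IsLayered K o ((oneSkeleton K).dist o) := by
  have := h.simplyConnected
  obtain ⟨d, hd⟩ := exists_isLayered (largeLinks_of_six_le_egirth h.six_le_girth_link) o
  rwa [hd.eq_dist] at hd

end Layers

/-! ### Squares in the layered structure and the two replacement rules. -/

section Squares

variable {V : Type u} {K : AbstractSimplicialComplex V} {o : V} {d : V → ℕ}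

/-- `u` is a neighbour of `v` one step closer to the basepoint. -/
def Down (K : AbstractSimplicialComplex V) (d : V → ℕ) (v u : V) : Prop :=
  (oneSkeleton K).Adj v u ∧ d u + 1 = d v

theorem IsLayered.tri (h : IsLayered K o d) {v u u' : V} (hu : Down K d v u)
    (hu' : Down K d v u') (hne : u ≠ u') : Tri K v u u' :=
  h.tri_of_down hu.1 hu'.1 hu.2 hu'.2 hne

theorem IsLayered.not_three_down (h : IsLayered K o d) (hK : LargeLinks K) {v a b c : V}
    (ha : Down K d v a) (hb : Down K d v b) (hc : Down K d v c) (hab : a ≠ b) (hbc : b ≠ c)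
    (hca : c ≠ a) : False :=
  hK.no_three (h.tri ha hb hab) (h.tri hb hc hbc) (h.tri hc ha hca)

/-- Some common parent `x` spans a triangle with `v` and `v'`; if `x ≠ w`, then `v`, `v'`, `w` form
a 3-cycle in the link of `x`. -/
theorem IsLayered.tri_of_common_down (h : IsLayered K o d) (hK : LargeLinks K) {v v' w : V}
    (hv : (oneSkeleton K).Adj v v') (hd : d v = d v') (hw : Down K d v w)
    (hw' : Down K d v' w) : Tri K v v' w := by
  obtain ⟨x, t, hx⟩ := h.exists_tri hv hd
  by_cases hne : w = x
  · rwa [hne]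
  · have h1 : Tri K v w x := h.tri hw ⟨t.adj', hx⟩ hne
    have h2 : Tri K v' w x := h.tri hw' ⟨t.rotate.adj, hx.trans hd⟩ hne
    exact (hK.no_three t.rotate.rotate h2.rotate.rotate.swap.swap h1.rotate.rotate.swap).elim

/-- How the square `u, a, b, a'` meets the link of `u`: either `a` and `a'` are adjacent there, or
both are adjacent there to the opposite vertex `b`. -/
def CornerShape (K : AbstractSimplicialComplex V) (d : V → ℕ) (u a b a' : V) : Prop :=
  Tri K u a a' ∨
    (Tri K u a b ∧ Tri K u b a' ∧ (Down K d a u → Down K d a b) ∧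
      (Down K d a' u → Down K d a' b) ∧ (Down K d a u ∨ Down K d a' u))

theorem CornerShape.symm {u a b a' : V} (h : CornerShape K d u a b a') :
    CornerShape K d u a' b a := by
  rcases h with h | ⟨h1, h2, h3, h4, h5⟩
  · exact .inl h.swap
  · exact .inr ⟨h2.swap, h1.swap, h4, h3, h5.symm⟩

/-- With `a` above `u` and `a'` below, `b` is level with `u`. Then `u` and `b` are parents of `a`,
hence adjacent, and `a'` is a common parent of both. -/
theorem IsLayered.cornerShape_of_up_down (h : IsLayered K o d) (hK : LargeLinks K)
    {u a b a' : V} (hub : u ≠ b) (hua : Down K d a u)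
    (hab : Down K d a b ∨ Down K d b a) (hba : Down K d b a' ∨ Down K d a' b)
    (hau : Down K d u a') : CornerShape K d u a b a' := by
  have hl : Down K d a b := hab.resolve_right fun e => by
    rcases hba with f | f <;> have := e.2 <;> have := f.2 <;> have := hua.2 <;>
      have := hau.2 <;> omega
  have hr : Down K d b a' := hba.resolve_right fun e => by
    have := hl.2; have := e.2; have := hua.2; have := hau.2; omega
  have t := h.tri hua hl hub
  have t' : Tri K u b a' := h.tri_of_common_down hK t.rotate.adj
    (by have := hua.2; have := hl.2; omega) hau hr
  exact .inr ⟨t.rotate.swap, t', fun _ => hl,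
    fun e => by have := e.2; have := hau.2; omega, .inl hua⟩

theorem IsLayered.cornerShape (h : IsLayered K o d) (hK : LargeLinks K) {u a b a' : V}
    (hub : u ≠ b) (haa : a ≠ a') (hua : Down K d u a ∨ Down K d a u)
    (hab : Down K d a b ∨ Down K d b a) (hba : Down K d b a' ∨ Down K d a' b)
    (hau : Down K d a' u ∨ Down K d u a') : CornerShape K d u a b a' := by
  rcases hua with hua | hua <;> rcases hau with hau | hau
  · exact (h.cornerShape_of_up_down hK hub hau hba.symm hab.symm hua).symm
  · exact .inl (h.tri hua hau haa)
  -- Both `a` and `a'` are above `u`, so `b` is level with `u` or two steps above it; the mixed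
  -- cases are inconsistent.
  · rcases hab with hab | hab <;> rcases hba with hba | hba
    · have := hab.2; have := hba.2; have := hua.2; have := hau.2; omega
    · exact .inr ⟨(h.tri hua hab hub).rotate.swap, (h.tri hau hba hub).rotate, fun _ => hab,
        fun _ => hba, .inl hua⟩
    · have t := h.tri hab hba haa
      exact .inl (h.tri_of_common_down hK t.rotate.adj
        (by have := hab.2; have := hba.2; omega) hua hau).rotate.rotate
    · have := hab.2; have := hba.2; have := hua.2; have := hau.2; omega
  · exact h.cornerShape_of_up_down hK hub hua hab hba hau

/-- Each corner joins consecutive `aᵢ` by a path of length 1 or 2 in the link of `u`, and together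
they close up into a cycle of length 3 to 6. Girth excludes all but 6. -/
theorem IsLayered.not_three_corners (h : IsLayered K o d) (hK : LargeLinks K)
    {u a₀ a₁ a₂ b₀ b₁ b₂ : V} (hnd : [u, a₀, a₁, a₂, b₀, b₁, b₂].Nodup)
    (h₀ : CornerShape K d u a₀ b₀ a₁) (h₁ : CornerShape K d u a₁ b₁ a₂)
    (h₂ : CornerShape K d u a₂ b₂ a₀) : False := by
  simp only [List.nodup_cons, List.mem_cons, List.not_mem_nil, or_false, not_or,
    List.nodup_nil, and_true, not_false_eq_true] at hnd
  obtain ⟨⟨-, -, -, hub₀, hub₁, hub₂⟩, ⟨h01, h02, hab00, hab01, hab02⟩,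
    ⟨h12, hab10, hab11, hab12⟩, ⟨hab20, hab21, hab22⟩, ⟨hb01, hb02⟩, hb12⟩ := hnd
  rcases h₀ with t₀ | ⟨p₀, q₀, r₀, s₀, e₀⟩ <;> rcases h₁ with t₁ | ⟨p₁, q₁, r₁, s₁, e₁⟩ <;>
    rcases h₂ with t₂ | ⟨p₂, q₂, r₂, s₂, e₂⟩
  · exact hK.no_three t₀ t₁ t₂
  · exact hK.no_four t₀ t₁ p₂ q₂ h02 hab12
  · exact hK.no_four t₀ p₁ q₁ t₂ hab01 h12
  · exact hK.no_five t₀ p₁ q₁ p₂ q₂ hab01 h12 hb12 (Ne.symm h02) (Ne.symm hab12)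
  · exact hK.no_four p₀ q₀ t₁ t₂ h01 (Ne.symm hab20)
  · exact hK.no_five p₀ q₀ t₁ p₂ q₂ h01 (Ne.symm hab20) hab12 (Ne.symm h02) (Ne.symm hb02)
  · exact hK.no_five p₀ q₀ p₁ q₁ t₂ h01 hb01 h12 (Ne.symm hab01) hab20
  -- In the hexagon case `a₀` or `a₁` is above `u`, and then has `u` and both adjacent `bᵢ` as three
  -- distinct parents.
  · rcases e₀ with e | e
    · exact h.not_three_down hK e (r₀ e) (s₂ e) hub₀ hb02 (Ne.symm hub₂)
    · exact h.not_three_down hK e (s₀ e) (r₁ e) hub₀ hb01 (Ne.symm hub₁)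

theorem squaring_isSquare_iff {a b c e : V} :
    (squaring K o).IsSquare a b c e ↔ IsFourCycle (squaringGraph K o) (cycleEdges a b c e) :=
  Iff.rfl

theorem IsFourCycle.adj {G : SimpleGraph V} {s : Set (Sym2 V)} (h : IsFourCycle G s) {v w : V}
    (hvw : s(v, w) ∈ s) : G.Adj v w := by
  obtain ⟨a, b, c, e, -, h1, h2, h3, h4, rfl⟩ := h
  rcases hvw with h | h | h | h
  all_goals
    rw [← SimpleGraph.mem_edgeSet, h]
    assumption

theorem SquareComplex.IsSquare.adj {X : SquareComplex V} {a b c e : V} (h : X.IsSquare a b c e) :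
    X.graph.Adj a b ∧ X.graph.Adj b c ∧ X.graph.Adj c e ∧ X.graph.Adj e a := by
  have h' := X.isFourCycle _ h
  refine ⟨h'.adj ?_, h'.adj ?_, h'.adj ?_, h'.adj ?_⟩ <;> simp [cycleEdges]

theorem IsTwoDimSystolic.down_or_down (h : IsTwoDimSystolic K) {v w : V}
    (hvw : (squaringGraph K o).Adj v w) :
    Down K ((oneSkeleton K).dist o) v w ∨ Down K ((oneSkeleton K).dist o) w v := by
  have h1 := (h.isLayered o).le_of_adj hvw.1
  have h2 := (h.isLayered o).le_of_adj hvw.1.symm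
  have h3 := hvw.2
  rcases Nat.lt_or_gt_of_ne h3 with h4 | h4
  · exact .inr ⟨hvw.1.symm, by omega⟩
  · exact .inl ⟨hvw.1, by omega⟩

theorem Down.squaringGraph_adj {v w : V} (h : Down K ((oneSkeleton K).dist o) v w) :
    (squaringGraph K o).Adj v w :=
  ⟨h.1, by have := h.2; omega⟩

theorem squaring_replace_two {u₀ u₁ v₀ v₁ v₂ : V} (hnd : [u₀, u₁, v₀, v₁, v₂].Nodup)
    (h : (squaring K o).IsSquare u₀ v₀ u₁ v₁) (h' : (squaring K o).IsSquare u₀ v₁ u₁ v₂) :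
    (squaring K o).IsSquare u₀ v₀ u₁ v₂ := by
  refine squaring_isSquare_iff.2 ⟨_, _, _, _, ?_, h.adj.1, h.adj.2.1, h'.adj.2.2.1,
    h'.adj.2.2.2, rfl⟩
  simp only [List.nodup_cons, List.mem_cons, List.not_mem_nil, or_false, not_or,
    List.nodup_nil, and_true, not_false_eq_true] at hnd ⊢
  grind

theorem IsTwoDimSystolic.cornerShape (h : IsTwoDimSystolic K) {u a b a' : V}
    (hs : (squaring K o).IsSquare u a b a') (hub : u ≠ b) (haa : a ≠ a') :
    CornerShape K ((oneSkeleton K).dist o) u a b a' :=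
  (h.isLayered o).cornerShape (largeLinks_of_six_le_egirth h.six_le_girth_link) hub haa
    (h.down_or_down hs.adj.1) (h.down_or_down hs.adj.2.1) (h.down_or_down hs.adj.2.2.1)
    (h.down_or_down hs.adj.2.2.2)

theorem IsTwoDimSystolic.not_three_squares (h : IsTwoDimSystolic K) {u a₀ a₁ a₂ b₀ b₁ b₂ : V}
    (hnd : [u, a₀, a₁, a₂, b₀, b₁, b₂].Nodup) (h₀ : (squaring K o).IsSquare u a₀ b₀ a₁)
    (h₁ : (squaring K o).IsSquare u a₁ b₁ a₂) (h₂ : (squaring K o).IsSquare u a₂ b₂ a₀) :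
    False := by
  have hd := hnd
  simp only [List.nodup_cons, List.mem_cons, List.not_mem_nil, or_false, not_or,
    List.nodup_nil, and_true, not_false_eq_true] at hd
  obtain ⟨⟨-, -, -, hub₀, hub₁, hub₂⟩, ⟨h01, h02, -⟩, ⟨h12, -⟩, -⟩ := hd
  exact (h.isLayered o).not_three_corners (largeLinks_of_six_le_egirth h.six_le_girth_link) hnd
    (h.cornerShape h₀ hub₀ h01) (h.cornerShape h₁ hub₁ h12) (h.cornerShape h₂ hub₂ (Ne.symm h02))

end Squares

/-! ### Homotopy classes of edges. -/

section EdgeClasses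

variable {V : Type u} {K : AbstractSimplicialComplex V}

/-- Two vertices, possibly equal, lie in a common face. -/
def Joined (K : AbstractSimplicialComplex V) (x y : V) : Prop := ∃ σ ∈ K.faces, x ∈ σ ∧ y ∈ σ

theorem joined_of_mem {σ : Finset V} (hσ : σ ∈ K.faces) {x y : V} (hx : x ∈ σ) (hy : y ∈ σ) :
    Joined K x y :=
  ⟨σ, hσ, hx, hy⟩

theorem Joined.symm {x y : V} (h : Joined K x y) : Joined K y x :=
  let ⟨σ, hσ, hx, hy⟩ := h
  ⟨σ, hσ, hy, hx⟩

/-- The homotopy class of the straight path between two vertices of a common face. -/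
noncomputable def edgeClass {x y : V} (h : Joined K x y) :
    Path.Homotopic.Quotient (vertexPoint K x) (vertexPoint K y) :=
  segmentClass (vertexPoint_supportedIn h.choose_spec.1 h.choose_spec.2.1)
    (vertexPoint_supportedIn h.choose_spec.1 h.choose_spec.2.2)

/-- The face enters a segment only through proofs, so the choice of face is immaterial by
definition. -/
theorem edgeClass_eq {x y : V} (h : Joined K x y) {σ : Finset V} (hσ : σ ∈ K.faces)
    (hx : x ∈ σ) (hy : y ∈ σ) :
    edgeClass h = segmentClass (vertexPoint_supportedIn hσ hx) (vertexPoint_supportedIn hσ hy) :=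
  rfl

theorem edgeClass_self {x : V} (h : Joined K x x) :
    edgeClass h = Path.Homotopic.Quotient.refl _ := segmentClass_self _

theorem edgeClass_trans {σ : Finset V} (hσ : σ ∈ K.faces) {x y z : V} (hx : x ∈ σ)
    (hy : y ∈ σ) (hz : z ∈ σ) (hxy : Joined K x y) (hyz : Joined K y z) (hxz : Joined K x z) :
    (edgeClass hxy).trans (edgeClass hyz) = edgeClass hxz := by
  rw [edgeClass_eq hxy hσ hx hy, edgeClass_eq hyz hσ hy hz, edgeClass_eq hxz hσ hx hz,
    segmentClass_trans]

theorem edgeClass_trans_symm {x y : V} (h : Joined K x y) (h' : Joined K y x) :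
    (edgeClass h).trans (edgeClass h') = Path.Homotopic.Quotient.refl _ := by
  obtain ⟨σ, hσ, hx, hy⟩ := id h
  rw [edgeClass_trans hσ hx hy hx h h' (joined_of_mem hσ hx hx), edgeClass_self]

theorem trans_edgeClass_symm {o x y : V} {p : Path.Homotopic.Quotient (vertexPoint K o)
    (vertexPoint K x)} {q : Path.Homotopic.Quotient (vertexPoint K o) (vertexPoint K y)}
    {h : Joined K x y} (hp : p.trans (edgeClass h) = q) (h' : Joined K y x) :
    q.trans (edgeClass h') = p := by
  rw [← hp, Path.Homotopic.Quotient.trans_assoc, edgeClass_trans_symm,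
    Path.Homotopic.Quotient.trans_refl]

end EdgeClasses

/-! ### Paths and potentials in the starring of a square complex. -/

section Starring

variable {V : Type u}

namespace SquareComplex

variable {X : SquareComplex V}

theorem joined_of_adj {v w : V} (h : X.graph.Adj v w) :
    Joined X.starring (.inl v) (.inl w) := by
  classical
  exact ⟨{.inl v, .inl w}, ⟨by simp, .inr (.inl ⟨v, w, h, by simp⟩)⟩, by simp, by simp⟩

theorem exists_face (s : X.squares) {v w : V} (h : s(v, w) ∈ s.1) :
    ∃ σ ∈ X.starring.faces, .inr s ∈ σ ∧ .inl v ∈ σ ∧ .inl w ∈ σ := by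
  classical
  exact ⟨{.inr s, .inl v, .inl w}, ⟨by simp, .inr (.inr ⟨s, v, w, h, by simp⟩)⟩,
    by simp, by simp, by simp⟩

theorem adj_of_mem (s : X.squares) {v w : V} (h : s(v, w) ∈ s.1) : X.graph.Adj v w :=
  (X.isFourCycle s.1 s.2).adj h

theorem joined_centre (s : X.squares) {v w : V} (h : s(v, w) ∈ s.1) :
    Joined X.starring (.inl v) (.inr s) :=
  let ⟨σ, hσ, h1, h2, _⟩ := exists_face s h
  ⟨σ, hσ, h2, h1⟩

theorem Joined.eq_or_adj {v w : V} (h : Joined X.starring (.inl v) (.inl w)) :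
    v = w ∨ X.graph.Adj v w := by
  obtain ⟨σ, ⟨-, ⟨a, hσ⟩ | ⟨a, b, hab, hσ⟩ | ⟨s, a, b, hab, hσ⟩⟩, hv, hw⟩ := h
  · have h1 := hσ hv
    have h2 := hσ hw
    simp at h1 h2
    exact .inl (h1.trans h2.symm)
  · have h1 := hσ hv
    have h2 := hσ hw
    simp at h1 h2
    rcases h1 with rfl | rfl <;> rcases h2 with rfl | rfl <;> simp [hab, hab.symm]
  · have h1 := hσ hv
    have h2 := hσ hw
    replace hab := adj_of_mem s hab
    simp at h1 h2
    rcases h1 with rfl | rfl <;> rcases h2 with rfl | rfl <;> simp [hab, hab.symm]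

theorem Joined.exists_mem {v : V} {s : X.squares} (h : Joined X.starring (.inl v) (.inr s)) :
    ∃ w, s(v, w) ∈ s.1 := by
  obtain ⟨σ, ⟨-, ⟨a, hσ⟩ | ⟨a, b, hab, hσ⟩ | ⟨t, a, b, hab, hσ⟩⟩, hv, hs⟩ := h
  · simpa using hσ hs
  · simpa using hσ hs
  · have h1 := hσ hv
    have h2 := hσ hs
    simp at h1 h2
    subst h2
    rcases h1 with rfl | rfl
    · exact ⟨_, hab⟩
    · exact ⟨_, Sym2.eq_swap ▸ hab⟩

theorem Joined.centre_eq {s t : X.squares} (h : Joined X.starring (.inr s) (.inr t)) :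
    s = t := by
  obtain ⟨σ, ⟨-, ⟨a, hσ⟩ | ⟨a, b, hab, hσ⟩ | ⟨r, a, b, hab, hσ⟩⟩, hs, ht⟩ := h
  · simpa using hσ hs
  · simpa using hσ hs
  · have h1 := hσ hs
    have h2 := hσ ht
    simp at h1 h2
    exact h1.trans h2.symm

/-- Each side of the square spans a face with the centre, so its two ends induce the same class
there; going round the sides compares all four corners. -/
theorem exists_centre_class {o : V}
    {g : ∀ v, Path.Homotopic.Quotient (vertexPoint X.starring (.inl o))
      (vertexPoint X.starring (.inl v))}
    (hg : ∀ v w (h : X.graph.Adj v w), (g v).trans (edgeClass (joined_of_adj h)) = g w)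
    (s : X.squares) :
    ∃ q : Path.Homotopic.Quotient (vertexPoint X.starring (.inl o))
      (vertexPoint X.starring (.inr s)),
      ∀ v (h : Joined X.starring (.inl v) (.inr s)), (g v).trans (edgeClass h) = q := by
  have key : ∀ v w (h : s(v, w) ∈ s.1) (h' : s(w, v) ∈ s.1),
      (g v).trans (edgeClass (joined_centre s h)) =
        (g w).trans (edgeClass (joined_centre s h')) := by
    intro v w h h'
    obtain ⟨σ, hσ, hs, hv, hw⟩ := exists_face s h
    rw [← hg v w (adj_of_mem s h), Path.Homotopic.Quotient.trans_assoc,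
      edgeClass_trans hσ hv hw hs]
  obtain ⟨a, b, c, d, -, -, -, -, -, hs⟩ := X.isFourCycle s.1 s.2
  have hab : s(a, b) ∈ s.1 := by simp [hs, cycleEdges]
  have hbc : s(b, c) ∈ s.1 := by simp [hs, cycleEdges]
  have hcd : s(c, d) ∈ s.1 := by simp [hs, cycleEdges]
  have hda : s(d, a) ∈ s.1 := by simp [hs, cycleEdges]
  have swap : ∀ {v w : V}, s(v, w) ∈ s.1 → s(w, v) ∈ s.1 := fun h => Sym2.eq_swap ▸ h
  have kb := key a b hab (swap hab)
  have kc := kb.trans (key b c hbc (swap hbc))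
  have kd := key a d (swap hda) hda
  refine ⟨(g a).trans (edgeClass (joined_centre s hab)), fun v h => ?_⟩
  obtain ⟨w, hw⟩ := Joined.exists_mem h
  rw [hs] at hw
  simp only [cycleEdges, Set.mem_insert_iff, Set.mem_singleton_iff, Sym2.eq_iff] at hw
  have hv : v = a ∨ v = b ∨ v = c ∨ v = d := by tauto
  rcases hv with rfl | rfl | rfl | rfl
  · rfl
  · exact kb.symm
  · exact kc.symm
  · exact kd.symm

theorem simplyConnectedSpace_of_potential (o : V)
    (g : ∀ v, Path.Homotopic.Quotient (vertexPoint X.starring (.inl o))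
      (vertexPoint X.starring (.inl v)))
    (hg : ∀ v w (h : X.graph.Adj v w), (g v).trans (edgeClass (joined_of_adj h)) = g w) :
    SimplyConnectedSpace X.Space := by
  choose c hc using exists_centre_class hg
  refine Quadric.simplyConnectedSpace_of_potential (.inl o) (fun x => match x with
    | .inl v => g v
    | .inr s => c s) ?_
  intro σ hσ x hx y hy
  have hj : Joined X.starring x y := ⟨σ, hσ, hx, hy⟩
  rw [← edgeClass_eq hj hσ hx hy]
  rcases x with v | s <;> rcases y with w | t
  · rcases Joined.eq_or_adj hj with rfl | h
    · rw [edgeClass_self, Path.Homotopic.Quotient.trans_refl]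
    · exact hg v w h
  · exact hc t v hj
  · exact trans_edgeClass_symm (hc s w hj.symm) hj
  · obtain rfl := Joined.centre_eq hj
    rw [edgeClass_self, Path.Homotopic.Quotient.trans_refl]

/-- Both halves of the boundary are homotopic to the path through the centre. -/
theorem edgeClass_trans_of_isSquare {a b c e : V} (h : X.IsSquare a b c e) :
    (edgeClass (joined_of_adj h.adj.1)).trans (edgeClass (joined_of_adj h.adj.2.1)) =
      (edgeClass (joined_of_adj h.adj.2.2.2.symm)).trans
        (edgeClass (joined_of_adj h.adj.2.2.1.symm)) := by
  let s : X.squares := ⟨_, h⟩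
  obtain ⟨σ₁, k₁, s₁, a₁, b₁⟩ := exists_face s (v := a) (w := b) (by simp [s, cycleEdges])
  obtain ⟨σ₂, k₂, s₂, b₂, c₂⟩ := exists_face s (v := b) (w := c) (by simp [s, cycleEdges])
  obtain ⟨σ₃, k₃, s₃, c₃, e₃⟩ := exists_face s (v := c) (w := e) (by simp [s, cycleEdges])
  obtain ⟨σ₄, k₄, s₄, e₄, a₄⟩ := exists_face s (v := e) (w := a) (by simp [s, cycleEdges])
  rw [← edgeClass_trans k₁ a₁ s₁ b₁ (joined_of_mem k₁ a₁ s₁) (joined_of_mem k₁ s₁ b₁),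
    ← edgeClass_trans k₄ a₄ s₄ e₄ (joined_of_mem k₄ a₄ s₄) (joined_of_mem k₄ s₄ e₄),
    Path.Homotopic.Quotient.trans_assoc, Path.Homotopic.Quotient.trans_assoc,
    edgeClass_trans k₂ s₂ b₂ c₂ _ _ (joined_of_mem k₂ s₂ c₂),
    edgeClass_trans k₃ s₃ e₃ c₃ _ _ (joined_of_mem k₃ s₃ c₃)]

end SquareComplex

end Starring

/-! ### Simple connectivity of the squaring, and the theorem. -/

section SimplyConnected

variable {V : Type u} {K : AbstractSimplicialComplex V} {o : V}

open SquareComplex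

/-- The two parents are adjacent and equidistant from `o`, so they have a common parent `w`,
opposite `v` in a 4-cycle of the squaring. -/
theorem IsTwoDimSystolic.exists_square (h : IsTwoDimSystolic K) {v u u' : V}
    (hu : Down K ((oneSkeleton K).dist o) v u) (hu' : Down K ((oneSkeleton K).dist o) v u')
    (hne : u ≠ u') : ∃ w, Down K ((oneSkeleton K).dist o) u w ∧
      Down K ((oneSkeleton K).dist o) u' w ∧ (squaring K o).IsSquare w u v u' := by
  have hL := h.isLayered o
  obtain ⟨w, t, hw⟩ := hL.exists_tri (hL.tri hu hu' hne).rotate.adj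
    (by have := hu.2; have := hu'.2; omega)
  have h1 : Down K ((oneSkeleton K).dist o) u w := ⟨t.adj', hw⟩
  have h2 : Down K ((oneSkeleton K).dist o) u' w :=
    ⟨t.rotate.adj, by have := hu.2; have := hu'.2; omega⟩
  refine ⟨w, h1, h2, squaring_isSquare_iff.2 ⟨w, u, v, u', ?_, h1.squaringGraph_adj.symm,
    hu.squaringGraph_adj.symm, hu'.squaringGraph_adj, h2.squaringGraph_adj, rfl⟩⟩
  have hwv : w ≠ v := by rintro rfl; have := hu.2; omega
  simp [h1.1.ne.symm, h2.1.ne.symm, hu.1.ne.symm, hu'.1.ne, hne, hwv]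

theorem IsTwoDimSystolic.exists_potential (h : IsTwoDimSystolic K) (o : V) :
    ∃ g : ∀ v, Path.Homotopic.Quotient (vertexPoint (squaring K o).starring (.inl o))
      (vertexPoint (squaring K o).starring (.inl v)),
    ∀ v w (hvw : (squaring K o).graph.Adj v w),
      (g v).trans (edgeClass (joined_of_adj hvw)) = g w := by
  have hL := h.isLayered o
  choose p hp using fun (v : V) (hv : (oneSkeleton K).dist o v ≠ 0) => hL.exists_down hv
  have hdown : ∀ v hv, Down K ((oneSkeleton K).dist o) v (p v hv) := fun v hv => hp v hv
  have hadj : ∀ {v u}, Down K ((oneSkeleton K).dist o) v u → (squaring K o).graph.Adj u v :=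
    fun k => k.squaringGraph_adj.symm
  -- The class of the descent from `v` through the chosen parents `p`, by recursion on the distance.
  let G : ∀ n v, (oneSkeleton K).dist o v = n →
      Path.Homotopic.Quotient (vertexPoint (squaring K o).starring (.inl o))
        (vertexPoint (squaring K o).starring (.inl v)) := fun n =>
    Nat.rec (fun v hv => hL.eq_zero_iff.1 hv ▸ Path.Homotopic.Quotient.refl _)
      (fun n ih v hv => (ih (p v (by omega)) (by have := (hdown v (by omega)).2; omega)).trans
        (edgeClass (joined_of_adj (hadj (hdown v (by omega)))))) n
  -- Any parent may replace the chosen one. At distance 1 the only parent is `o`; beyond, the square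
  -- on the two parents and the inductive hypothesis at their common parent compare the two
  -- descents.
  have hG : ∀ n v u (hv : (oneSkeleton K).dist o v = n + 1)
      (k : Down K ((oneSkeleton K).dist o) v u),
      (G n u (by have := k.2; omega)).trans (edgeClass (joined_of_adj (hadj k))) =
        G (n + 1) v hv := by
    intro n
    induction n with
    | zero =>
      intro v u hv k
      have hu : u = o := hL.eq_zero_iff.1 (by have := k.2; omega)
      have hq := hdown v (by omega)
      have hq' : p v (by omega) = o := hL.eq_zero_iff.1 (by have := hq.2; omega)
      obtain rfl : u = p v (by omega) := hu.trans hq'.symm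
      rfl
    | succ n ih =>
      intro v u hv k
      have hq := hdown v (by omega)
      by_cases hne : u = p v (by omega)
      · subst hne
        rfl
      · obtain ⟨w, k₁, k₂, hs⟩ := h.exists_square k hq hne
        change _ = (G (n + 1) (p v (by omega)) (by have := hq.2; omega)).trans
          (edgeClass (joined_of_adj (hadj hq)))
        rw [← ih u w (by have := k.2; omega) k₁, ← ih (p v _) w (by have := hq.2; omega) k₂,
          Path.Homotopic.Quotient.trans_assoc, Path.Homotopic.Quotient.trans_assoc,
          edgeClass_trans_of_isSquare hs]
  have hG' : ∀ v u (k : Down K ((oneSkeleton K).dist o) v u),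
      (G _ u rfl).trans (edgeClass (joined_of_adj (hadj k))) = G _ v rfl := by
    intro v u k
    have : ∀ n (hn : (oneSkeleton K).dist o v = n), G n v hn = G _ v rfl := by
      rintro _ rfl
      rfl
    rw [← this _ k.2.symm]
    exact hG _ v u k.2.symm k
  refine ⟨fun v => G _ v rfl, fun v w hvw => ?_⟩
  rcases h.down_or_down hvw with k | k
  · exact trans_edgeClass_symm (hG' v w k) _
  · exact hG' w v k

theorem IsTwoDimSystolic.isQuadric_squaring (h : IsTwoDimSystolic K) (o : V) :
    (squaring K o).IsQuadric where
  simplyConnected := by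
    obtain ⟨g, hg⟩ := h.exists_potential o
    exact SquareComplex.simplyConnectedSpace_of_potential o g hg
  replace_two _ _ _ _ _ hnd h₁ h₂ := squaring_replace_two hnd h₁ h₂
  replace_three _ _ _ _ _ _ _ hnd h₀ h₁ h₂ := (h.not_three_squares hnd h₀ h₁ h₂).elim

end SimplyConnected

end Quadric

theorem mainTheorem4 {V : Type*} (Y : AbstractSimplicialComplex V)
    (hY : Quadric.IsTwoDimSystolic Y) (o : V) :
    (Quadric.squaring Y o).IsQuadric :=
  hY.isQuadric_squaring o
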